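/- Let $K$ be a field of characteristic $p>3$ and let $A$ be a commutative associative unital $K$-algebra (of arbitrary dimension). Let $W_1(1)$ be the Lie algebra over $K$ with basis $e_{-1},e_0,\dots,e_{p-2}$ and bracket $[e_i,e_j]=N_{ij}e_{i+j}$, where $N_{ij}=\binom{i+j+1}{j}-\binom{i+j+1}{i}$ and $e_k=0$ unless $-1\le k\le p-2$, and let $W_1(1)\otimes A$ (tensor product over $K$) have the bracket $[x\otimes a,y\otimes b]=[x,y]\otimes ab$. Let $\mathrm{Der}(A)$ be the space of $K$-linear derivations of $A$. For a Lie algebra $L$ let $Z^n(L,L)$ and $H^n(L,L)$ be the cocycles and the cohomology of $L$ with values in the adjoint module. Let $\mathcal Z^2(A,A)$ be the space of symmetric $K$-bilinear maps $F:A\times A\to A$ with $aF(b,c)-F(ab,c)+F(a,bc)-F(a,b)c=0$, and let $\mathrm{Har}^2(A,A)$ be its quotient by the maps $(a,b)\mapsto aG(b)+bG(a)-G(ab)$ with $G\in\mathrm{Hom}_K(A,A)$. For $\varphi\in Z^2(W_1(1),W_1(1))$, $u\in A$, $D\in\mathrm{Der}(A)$ and $F\in\mathcal Z^2(A,A)$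 define alternating bilinear maps on $W_1(1)\otimes A$ by $$\Theta_{\varphi,u}(x\otimes a,y\otimes b)=\varphi(x,y)\otimes abu,\qquad \Upsilon_F(x\otimes a,y\otimes b)=[x,y]\otimes F(a,b),$$ $$\Psi_D(e_i\otimes a,e_j\otimes b)=\begin{cases}e_{i+j}\otimes\bigl(\binom{i+j+1}{j}bD(a)-\binom{i+j+1}{i}aD(b)\bigr),&-2<i+j<p-1,\\0,&\text{otherwise,}\end{cases}$$ $$\Phi_D(e_i\otimes a,e_j\otimes b)=\begin{cases}e_{p-2}\otimes(aD(b)-bD(a)),&i=j=-1,\\0,&\text{otherwise}\end{cases}$$ (a binomial coefficient with lower entry $-1$ is $0$). Let $\varphi_0$ be the alternating bilinear map on $W_1(1)$ with $\varphi_0(e_i,e_j)=(N_{ij}/p)\,e_{i+j-p}$ if $i+j\ge p-1$ (where $N_{ij}/p$ is the integer quotient reduced modulo $p$) and $\varphi_0(e_i,e_j)=0$ otherwise. 1. Each map $1\otimes D: x\otimes a\mapsto x\otimes D(a)$ with $D\in\mathrm{Der}(A)$ is a 1-cocycle, and $D\mapsto[1\otimes D]$ is a $K$-linear isomorphism $\mathrm{Der}(A)\cong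 H^1(W_1(1)\otimes A,W_1(1)\otimes A)$. 2. All the maps $\varphi_0$, $\Theta_{\varphi,u}$, $\Psi_D$, $\Phi_D$, $\Upsilon_F$ are 2-cocycles, and there is a $K$-linear isomorphism $$H^2(W_1(1),W_1(1))\otimes A\,\oplus\,\mathrm{Der}(A)\,\oplus\,\mathrm{Der}(A)\,\oplus\,\mathrm{Har}^2(A,A)\;\cong\;H^2(W_1(1)\otimes A,W_1(1)\otimes A)$$ such that $([\varphi]\otimes u,\,D,\,E,\,[F])\mapsto[\Theta_{\varphi,u}]+[\Psi_D]+[\Phi_E]+[\Upsilon_F]$ for all $\varphi\in Z^2(W_1(1),W_1(1))$, $u\in A$, $D,E\in\mathrm{Der}(A)$ and $F\in\mathcal Z^2(A,A)$. Moreover, the classes of the cocycles $\Theta_{\varphi_0,u}$ ($u\in A$), $\Psi_D$ and $\Phi_D$ ($D\in\mathrm{Der}(A)$) and $\Upsilon_F$ ($F\in\mathcal Z^2(A,A)$) span $H^2(W_1(1)\otimes A,W_1(1)\otimes A)$ over $K$. -/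

import Mathlib

open scoped TensorProduct

noncomputable section

namespace CurrentWitt

open LieModule.Cohomology

/-! ## Lie algebra cohomology with adjoint coefficients in degrees 1 and 2

The cochains, the differentials and the 2-cocycles are those of Mathlib. -/

section LieCohomology

variable (K L : Type*) [CommRing K] [LieRing L] [LieAlgebra K L]

/-- The space `Z¹(L, L)` of 1-cocycles with values in the adjoint module. -/
def oneCocycle : Submodule K (oneCochain K L L) := LinearMap.ker (d₁₂ K L L)

/-- The space `B¹(L, L)`: the maps `y ↦ ⁅x, y⁆` for `x ∈ L`. -/
def oneCoboundary : Submodule K (oneCochain K L L) :=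
  LinearMap.range (LieAlgebra.ad K L : L →ₗ[K] Module.End K L)

/-- The abelian group structure on 2-cocycles (a shortcut for instance search). -/
instance : AddCommGroup (twoCocycle K L L) :=
  @Submodule.addCommGroup K (twoCochain K L L) _ (Submodule.addCommGroup _) _ (twoCocycle K L L)

/-- The first cohomology `H¹(L, L)` with values in the adjoint module. -/
abbrev H1 : Type _ := oneCocycle K L ⧸ (oneCoboundary K L).submoduleOf (oneCocycle K L)

/-- The space `B²(L, L)` of 2-coboundaries with values in the adjoint module. -/
def twoCoboundary : Submodule K (twoCochain K L L) := LinearMap.range (d₁₂ K L L)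

/-- The second cohomology `H²(L, L)` with values in the adjoint module. -/
abbrev H2 : Type _ := twoCocycle K L L ⧸ (twoCoboundary K L).submoduleOf (twoCocycle K L L)

variable {K L}

/-- The class in `H¹(L, L)` of a 1-cocycle. -/
def H1.cls : oneCocycle K L →ₗ[K] H1 K L := Submodule.mkQ _

/-- The class in `H²(L, L)` of a 2-cocycle. -/
def H2.cls : twoCocycle K L L →ₗ[K] H2 K L := Submodule.mkQ _

end LieCohomology

/-! ## The second Harrison cohomology of a commutative algebra -/

section Harrison

variable (K A : Type*) [CommRing K] [CommRing A] [Algebra K A]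

/-- Harrison 2-cocycles: symmetric Hochschild 2-cocycles of `A` with values in `A`. -/
def harrisonCocycle : Submodule K (A →ₗ[K] A →ₗ[K] A) where
  carrier := {F | (∀ a b, F a b = F b a) ∧
    ∀ a b c, a * F b c - F (a * b) c + F a (b * c) - F a b * c = 0}
  add_mem' {F G} hF hG := by
    refine ⟨fun a b => by simp [hF.1 a b, hG.1 a b], fun a b c => ?_⟩
    simp only [LinearMap.add_apply]
    linear_combination hF.2 a b c + hG.2 a b c
  zero_mem' := by simp
  smul_mem' k F hF := by
    refine ⟨fun a b => by simp [hF.1 a b], fun a b c => ?_⟩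
    simp only [LinearMap.smul_apply, mul_smul_comm, smul_mul_assoc, ← smul_sub, ← smul_add,
      hF.2 a b c, smul_zero]

/-- The coboundary operator `δ`, with `δG(a, b) = a G(b) + b G(a) - G(ab)`. -/
def harrisonDelta : (A →ₗ[K] A) →ₗ[K] (A →ₗ[K] A →ₗ[K] A) where
  toFun G := (LinearMap.mul K A).compl₂ G + ((LinearMap.mul K A).compl₂ G).flip
    - (LinearMap.mul K A).compr₂ G
  map_add' F G := by
    ext a b
    simp
    ring
  map_smul' k F := by
    ext a b
    simp [smul_sub]

/-- Harrison 2-coboundaries. -/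
def harrisonCoboundary : Submodule K (A →ₗ[K] A →ₗ[K] A) := LinearMap.range (harrisonDelta K A)

/-- The abelian group structure on Harrison 2-cocycles (a shortcut for instance search). -/
instance : AddCommGroup (harrisonCocycle K A) :=
  @Submodule.addCommGroup K (A →ₗ[K] A →ₗ[K] A) _ LinearMap.addCommGroup _ (harrisonCocycle K A)

/-- The second Harrison cohomology `Har²(A, A)`. -/
abbrev Har2 : Type _ :=
  harrisonCocycle K A ⧸ (harrisonCoboundary K A).submoduleOf (harrisonCocycle K A)

variable {K A}

/-- The class in `Har²(A, A)` of a Harrison 2-cocycle. -/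
def Har2.cls : harrisonCocycle K A →ₗ[K] Har2 K A := Submodule.mkQ _

end Harrison

/-! ## The Witt algebra `W₁(1)`

As a vector space `W₁(1)` has the basis `e_{-1}, e_0, …, e_{p-2}`. All indices below are shifted by
one: the natural number `s` stands for `e_{s-1}`. -/

/-- The underlying vector space of `W₁(1)`; the coordinate `s` is the coefficient of `e_{s-1}`. -/
def W (p : ℕ) (K : Type*) : Type _ := Fin p → K

namespace W

variable (p : ℕ) (K : Type*) [Field K]

instance : AddCommGroup (W p K) := inferInstanceAs (AddCommGroup (Fin p → K))

instance : Module K (W p K) := inferInstanceAs (Module K (Fin p → K))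

/-- The basis `e_{-1}, …, e_{p-2}` (the index `s` gives `e_{s-1}`). -/
def basis : Module.Basis (Fin p) K (W p K) := Pi.basisFun K (Fin p)

/-- The element `e_{s-1}` for `s < p`, and `0` for `p ≤ s`. -/
def e (s : ℕ) : W p K := if h : s < p then basis p K ⟨s, h⟩ else 0

variable {p K}

lemma e_coe (s : Fin p) : e p K (s : ℕ) = basis p K s := by
  simp [e]

/-- The bilinear map on `W₁(1)` with `(e_{s-1}, e_{t-1}) ↦ c s t`. -/
def bilin (c : ℕ → ℕ → W p K) : W p K →ₗ[K] W p K →ₗ[K] W p K :=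
  (basis p K).constr K fun s => (basis p K).constr K fun t => c s t

lemma bilin_basis (c : ℕ → ℕ → W p K) (s t : Fin p) :
    bilin c (basis p K s) (basis p K t) = c s t := by
  simp [bilin]

lemma bilin_e (c : ℕ → ℕ → W p K) {s t : ℕ} (hs : s < p) (ht : t < p) :
    bilin c (e p K s) (e p K t) = c s t := by
  simp [e, hs, ht, bilin_basis]

lemma bilin_self (c : ℕ → ℕ → W p K) (h : ∀ s t, s < p → t < p → c s t + c t s = 0)
    (h0 : ∀ s, s < p → c s s = 0) (x : W p K) : bilin c x x = 0 := by
  have hx : bilin c x x = ∑ q : Fin p × Fin p,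
      ((basis p K).repr x q.1 * (basis p K).repr x q.2) • c q.1 q.2 := by
    conv_lhs => rw [← (basis p K).sum_repr x]
    simp only [map_sum, LinearMap.sum_apply, map_smul, LinearMap.smul_apply, bilin_basis,
      Fintype.sum_prod_type, Finset.smul_sum, smul_smul]
    rw [Finset.sum_comm]
    exact Finset.sum_congr rfl fun _ _ => Finset.sum_congr rfl fun _ _ => by rw [mul_comm]
  rw [hx]
  refine Finset.sum_involution (fun q _ => (q.2, q.1)) (fun q _ => ?_) (fun q _ hq hq' => hq ?_)
    (fun _ _ => Finset.mem_univ _) (fun _ _ => rfl)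
  · rw [mul_comm ((basis p K).repr x q.2), ← smul_add, h _ _ q.1.2 q.2.2, smul_zero]
  · have : q.2 = q.1 := congrArg Prod.fst hq'
    rw [this, h0 _ q.1.2, smul_zero]

/-- The structure constants of `W₁(1)` as integers. In terms of `i = s - 1`, `j = t - 1` this is
`N_{ij} = binom(i+j+1, j) - binom(i+j+1, i)`, since `binom(i+j+1, j) = binom(i+j+1, i+1)`. -/
def N (s t : ℕ) : ℤ := (s + t - 1).choose s - (s + t - 1).choose t

lemma N_swap (s t : ℕ) : N s t = -N t s := by
  simp [N, add_comm t s]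

lemma N_self (s : ℕ) : N s s = 0 := by
  simp [N]

lemma dvd_N {p : ℕ} (hp : p.Prime) {s t : ℕ} (hs : s < p) (ht : t < p) (h : p < s + t) :
    (p : ℤ) ∣ N s t := by
  have key : ∀ s t : ℕ, s < p → t < p → p < s + t → (p : ℤ) ∣ ((s + t - 1).choose s : ℕ) := by
    intro s t hs ht h
    rw [Int.natCast_dvd_natCast, show s + t - 1 = s + (t - 1) by omega]
    exact hp.dvd_choose_add hs (by omega) (by omega)
  refine dvd_sub (key s t hs ht h) ?_
  rw [add_comm s t]
  exact key t s ht hs (by omega)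

lemma N_factorial (s t : ℕ) (h : 1 ≤ s + t) :
    (N s t : ℚ) = ((t : ℚ) - s) * (s + t - 1).factorial / (s.factorial * t.factorial) := by
  have key : ∀ s t : ℕ, 1 ≤ s + t → (((s + t - 1).choose s : ℕ) : ℚ) =
      (t : ℚ) * (s + t - 1).factorial / (s.factorial * t.factorial) := by
    intro s t h
    rcases t with _ | t
    · rw [Nat.choose_eq_zero_of_lt (by omega)]
      simp
    · rw [show s + (t + 1) - 1 = s + t by omega, Nat.cast_add_choose, Nat.factorial_succ]
      have h1 : (s.factorial : ℚ) ≠ 0 := by exact_mod_cast s.factorial_ne_zero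
      have h2 : (t.factorial : ℚ) ≠ 0 := by exact_mod_cast t.factorial_ne_zero
      have h3 : (t : ℚ) + 1 ≠ 0 := by positivity
      push_cast
      field_simp
  have h1 := key s t h
  have h2 := key t s (by omega)
  rw [add_comm t s] at h2
  rw [N]
  push_cast
  rw [h1, h2]
  ring

lemma N_jacobi (s t u : ℕ) :
    N t u * N s (t + u - 1) = N s t * N (s + t - 1) u + N s u * N t (s + u - 1) := by
  have h00 : N 0 0 = 0 := N_self 0
  by_cases h1 : t + u = 0
  · obtain ⟨rfl, rfl⟩ : t = 0 ∧ u = 0 := by omega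
    simp only [h00, add_zero]
    rw [N_swap 0 (s - 1)]
    ring
  by_cases h2 : s + t = 0
  · obtain ⟨rfl, rfl⟩ : s = 0 ∧ t = 0 := by omega
    simp only [h00, zero_add]
    ring
  by_cases h3 : s + u = 0
  · obtain ⟨rfl, rfl⟩ : s = 0 ∧ u = 0 := by omega
    simp only [h00, zero_add, add_zero]
    rw [N_swap 0 (t - 1), N_swap t 0]
    ring
  have hq : ((N t u * N s (t + u - 1) : ℤ) : ℚ) =
      ((N s t * N (s + t - 1) u + N s u * N t (s + u - 1) : ℤ) : ℚ) := by
    push_cast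
    rw [N_factorial t u (by omega), N_factorial s t (by omega), N_factorial s u (by omega),
      N_factorial s (t + u - 1) (by omega), N_factorial (s + t - 1) u (by omega),
      N_factorial t (s + u - 1) (by omega),
      show s + (t + u - 1) - 1 = s + t + u - 2 by omega,
      show s + t - 1 + u - 1 = s + t + u - 2 by omega,
      show t + (s + u - 1) - 1 = s + t + u - 2 by omega]
    rw [Nat.cast_sub (by omega : 1 ≤ t + u), Nat.cast_sub (by omega : 1 ≤ s + t),
      Nat.cast_sub (by omega : 1 ≤ s + u)]
    have f : ∀ n : ℕ, (n.factorial : ℚ) ≠ 0 := fun n => by exact_mod_cast n.factorial_ne_zero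
    have f1 := f s
    have f2 := f t
    have f3 := f u
    have f4 := f (t + u - 1)
    have f5 := f (s + t - 1)
    have f6 := f (s + u - 1)
    push_cast
    field_simp
    ring
  exact_mod_cast hq

/-- The multiplication of `W₁(1)`: `[e_i, e_j] = N_{ij} e_{i+j}`, where `e_{i+j}` is read as `0` if
`i + j` is not between `-1` and `p - 2`. -/
def bracket : W p K →ₗ[K] W p K →ₗ[K] W p K :=
  bilin fun s t => (N s t : K) • e p K (s + t - 1)

lemma bracket_self (x : W p K) : bracket x x = 0 := by
  refine bilin_self _ (fun s t _ _ => ?_) (fun s _ => by simp [N_self]) x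
  rw [N_swap s t, add_comm t s]
  simp

lemma bracket_bracket_basis [Fact p.Prime] [CharP K p] (s t u : Fin p) :
    bracket (basis p K s) (bracket (basis p K t) (basis p K u)) =
      ((N t u * N s (t + u - 1) : ℤ) : K) • e p K (s + t + u - 2) := by
  have h : bracket (basis p K t) (basis p K u) = (N t u : K) • e p K (t + u - 1) :=
    bilin_basis _ _ _
  rw [h, map_smul]
  by_cases h0 : (t : ℕ) + u = 0
  · obtain ⟨ht, hu⟩ : (t : ℕ) = 0 ∧ (u : ℕ) = 0 := by omega
    simp [ht, hu, N_self]
  by_cases hlt : (t : ℕ) + u - 1 < p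
  · rw [← e_coe s, bracket, bilin_e _ s.2 hlt, smul_smul,
      show (s : ℕ) + (t + u - 1) - 1 = s + t + u - 2 by omega]
    push_cast
    rfl
  · have : ((N t u : ℤ) : K) = 0 :=
      (CharP.intCast_eq_zero_iff K p _).2 (dvd_N Fact.out t.2 u.2 (by omega))
    simp [this]

lemma bracket_leibniz [Fact p.Prime] [CharP K p] (x y z : W p K) :
    bracket x (bracket y z) = bracket (bracket x y) z + bracket y (bracket x z) := by
  have skew : ∀ a b : W p K, bracket a b = -bracket b a := fun a b => by
    have := bracket_self (a + b)
    simp only [map_add, LinearMap.add_apply, bracket_self, zero_add, add_zero] at this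
    exact eq_neg_of_add_eq_zero_right this
  have ext1 : ∀ f g : W p K →ₗ[K] W p K, (∀ s, f (basis p K s) = g (basis p K s)) →
      ∀ x, f x = g x := fun f g h => LinearMap.congr_fun ((basis p K).ext h)
  refine ext1 (bracket.flip (bracket y z))
    (bracket.flip z ∘ₗ bracket.flip y + bracket y ∘ₗ bracket.flip z) (fun s => ?_) x
  refine ext1 (bracket (basis p K s) ∘ₗ bracket.flip z)
    (bracket.flip z ∘ₗ bracket (basis p K s) + bracket.flip (bracket (basis p K s) z))
    (fun t => ?_) y
  refine ext1 (bracket (basis p K s) ∘ₗ bracket (basis p K t))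
    (bracket (bracket (basis p K s) (basis p K t)) + bracket (basis p K t) ∘ₗ
      bracket (basis p K s)) (fun u => ?_) z
  simp only [LinearMap.add_apply, LinearMap.comp_apply]
  rw [skew (bracket (basis p K s) (basis p K t)) (basis p K u), bracket_bracket_basis,
    bracket_bracket_basis, bracket_bracket_basis, N_jacobi, N_swap u,
    show (u : ℕ) + s + t - 2 = s + t + u - 2 by omega,
    show (t : ℕ) + s + u - 2 = s + t + u - 2 by omega]
  push_cast
  module

instance [Fact p.Prime] [CharP K p] : LieRing (W p K) where
  bracket x y := bracket x y
  add_lie x y z := by simp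
  lie_add x y z := by simp
  lie_self := bracket_self
  leibniz_lie := bracket_leibniz

instance [Fact p.Prime] [CharP K p] : LieAlgebra K (W p K) where
  lie_smul k x y := by simp [Bracket.bracket]

lemma lie_def [Fact p.Prime] [CharP K p] (x y : W p K) : ⁅x, y⁆ = bracket x y := rfl

lemma lie_basis [Fact p.Prime] [CharP K p] (s t : Fin p) :
    ⁅basis p K s, basis p K t⁆ = (N s t : K) • e p K (s + t - 1) :=
  bilin_basis _ _ _

/-- The cochain `φ` on `W₁(1)` with `φ(e_i, e_j) = (N_{ij}/p) e_{i+j-p}` if `i + j ≥ p - 1`, and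
`0` otherwise. The integer `N_{ij}` is divisible by `p` in the first case, and `N_{ij}/p` is the
reduction modulo `p` of the quotient. -/
def phi (p : ℕ) (K : Type*) [Field K] [Fact p.Prime] [CharP K p] :
    twoCochain K (W p K) (W p K) :=
  ⟨bilin fun s t => if p + 1 ≤ s + t then ((N s t / p : ℤ) : K) • e p K (s + t - 1 - p) else 0, by
    refine bilin_self _ (fun s t hs ht => ?_) (fun s _ => by simp [N_self])
    by_cases h : p + 1 ≤ s + t
    · rw [if_pos h, if_pos (by omega), N_swap s t, add_comm t s,
        Int.neg_ediv_of_dvd (dvd_N Fact.out ht hs (by omega))]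
      simp
    · rw [if_neg h, if_neg (by omega), add_zero]⟩

/-- The bilinear map `(e_i, e_j) ↦ binom(i+j+1, j) e_{i+j}` if `-2 < i + j < p - 1`, and `0`
otherwise. Here `i = s - 1`, `j = t - 1` and `binom(i+j+1, j) = binom(s+t-1, s)`. -/
def psi : W p K →ₗ[K] W p K →ₗ[K] W p K :=
  bilin fun s t => if 1 ≤ s + t then ((s + t - 1).choose s : K) • e p K (s + t - 1) else 0

/-- The bilinear map with `(e_{-1}, e_{-1}) ↦ e_{p-2}` that vanishes on all other pairs of basis
elements. -/
def chi : W p K →ₗ[K] W p K →ₗ[K] W p K :=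
  bilin fun s t => if s = 0 ∧ t = 0 then e p K (p - 1) else 0

lemma chi_symm (x y : W p K) : chi x y = chi y x := by
  have : chi (p := p) (K := K) = chi.flip := by
    refine (basis p K).ext fun s => (basis p K).ext fun t => ?_
    simp only [LinearMap.flip_apply, chi, bilin_basis, and_comm]
  exact LinearMap.congr_fun (LinearMap.congr_fun this x) y

end W

/-! ## The current Lie algebra `W₁(1) ⊗ A` and its basic cocycles

Mathlib's Lie algebra `A ⊗[K] L` has the bracket `[a ⊗ x, b ⊗ y] = ab ⊗ [x, y]`, so it is `L ⊗ A`
with the two tensor factors written in the other order. -/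

section Current

variable {K A L : Type*} [Field K] [CommRing A] [Algebra K A]

/-- A bilinear map on `A ⊗ V` is alternating if it is so on pure tensors. -/
lemma alternating_of_tmul {V M : Type*} [AddCommGroup V] [Module K V] [AddCommGroup M] [Module K M]
    (B : A ⊗[K] V →ₗ[K] A ⊗[K] V →ₗ[K] M)
    (h : ∀ a b x y, B (a ⊗ₜ x) (b ⊗ₜ y) + B (b ⊗ₜ y) (a ⊗ₜ x) = 0)
    (h0 : ∀ a x, B (a ⊗ₜ x) (a ⊗ₜ x) = 0) (z : A ⊗[K] V) : B z z = 0 := by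
  have skew : B + B.flip = 0 := by
    refine TensorProduct.ext' fun a x => TensorProduct.ext' fun b y => ?_
    simpa using h a b x y
  induction z with
  | zero => simp
  | tmul a x => exact h0 a x
  | add z w hz hw =>
    have := LinearMap.congr_fun (LinearMap.congr_fun skew z) w
    simp only [LinearMap.add_apply, LinearMap.flip_apply, LinearMap.zero_apply] at this
    simp [hz, hw, this, add_comm (B w z)]

/-- The cochain `Θ_{φ,u}` with `(x ⊗ a, y ⊗ b) ↦ φ(x, y) ⊗ abu`. -/
def Theta [LieRing L] [LieAlgebra K L] (φ : twoCochain K L L) (u : A) :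
    twoCochain K (A ⊗[K] L) (A ⊗[K] L) :=
  ⟨TensorProduct.map₂ ((LinearMap.mul K A).compr₂ (LinearMap.mulRight K u)) φ.1,
    alternating_of_tmul _
      (fun a b x y => by
        change (a * b * u) ⊗ₜ[K] φ x y + (b * a * u) ⊗ₜ[K] φ y x = 0
        rw [mul_comm b a, ← twoCochain_skew φ x y, TensorProduct.tmul_neg, add_neg_cancel])
      (fun a x => by
        change (a * a * u) ⊗ₜ[K] φ x x = 0
        rw [twoCochain_alt, TensorProduct.tmul_zero])⟩

lemma Theta_tmul [LieRing L] [LieAlgebra K L] (φ : twoCochain K L L) (u a b : A) (x y : L) :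
    Theta φ u (a ⊗ₜ x) (b ⊗ₜ y) = (a * b * u) ⊗ₜ[K] φ x y := rfl

/-- The cochain `Υ_F` with `(x ⊗ a, y ⊗ b) ↦ [x, y] ⊗ F(a, b)`. -/
def Upsilon (L : Type*) [LieRing L] [LieAlgebra K L] (F : harrisonCocycle K A) :
    twoCochain K (A ⊗[K] L) (A ⊗[K] L) :=
  ⟨TensorProduct.map₂ F.1 (LieAlgebra.ad K L : L →ₗ[K] Module.End K L),
    alternating_of_tmul _
      (fun a b x y => by
        change F.1 a b ⊗ₜ[K] ⁅x, y⁆ + F.1 b a ⊗ₜ[K] ⁅y, x⁆ = 0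
        rw [F.2.1 b a, ← lie_skew x y, TensorProduct.tmul_neg, neg_add_cancel])
      (fun a x => by
        change F.1 a a ⊗ₜ[K] ⁅x, x⁆ = 0
        rw [lie_self, TensorProduct.tmul_zero])⟩

lemma Upsilon_tmul [LieRing L] [LieAlgebra K L] (F : harrisonCocycle K A) (a b : A) (x y : L) :
    Upsilon L F (a ⊗ₜ x) (b ⊗ₜ y) = F.1 a b ⊗ₜ[K] ⁅x, y⁆ := rfl

variable {p : ℕ} [Fact p.Prime] [CharP K p]

/-- The cochain `Ψ_D` with
`(e_i ⊗ a, e_j ⊗ b) ↦ e_{i+j} ⊗ (binom(i+j+1, j) b D(a) - binom(i+j+1, i) a D(b))` if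
`-2 < i + j < p - 1`, and `0` otherwise. -/
def Psi (p : ℕ) [Fact p.Prime] [CharP K p] (D : Derivation K A A) :
    twoCochain K (A ⊗[K] W p K) (A ⊗[K] W p K) :=
  ⟨TensorProduct.map₂ ((LinearMap.mul K A).comp D.toLinearMap) W.psi
      + TensorProduct.map₂ (-(LinearMap.mul K A).compl₂ D.toLinearMap) W.psi.flip,
    alternating_of_tmul _
      (fun a b x y => by
        change (D a * b) ⊗ₜ[K] W.psi x y + (-(a * D b)) ⊗ₜ[K] W.psi y x +
          ((D b * a) ⊗ₜ[K] W.psi y x + (-(b * D a)) ⊗ₜ[K] W.psi x y) = 0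
        rw [mul_comm b, mul_comm a, TensorProduct.neg_tmul, TensorProduct.neg_tmul]
        abel)
      (fun a x => by
        change (D a * a) ⊗ₜ[K] W.psi x x + (-(a * D a)) ⊗ₜ[K] W.psi x x = 0
        rw [mul_comm a, TensorProduct.neg_tmul, add_neg_cancel])⟩

lemma Psi_tmul (D : Derivation K A A) (a b : A) (x y : W p K) :
    Psi p D (a ⊗ₜ x) (b ⊗ₜ y) =
      (D a * b) ⊗ₜ[K] W.psi x y - (a * D b) ⊗ₜ[K] W.psi y x := by
  rw [sub_eq_add_neg, ← TensorProduct.neg_tmul]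
  rfl

/-- The cochain `Φ_D` with `(e_{-1} ⊗ a, e_{-1} ⊗ b) ↦ e_{p-2} ⊗ (a D(b) - b D(a))`, and
`(e_i ⊗ a, e_j ⊗ b) ↦ 0` otherwise. -/
def Phi (p : ℕ) [Fact p.Prime] [CharP K p] (D : Derivation K A A) :
    twoCochain K (A ⊗[K] W p K) (A ⊗[K] W p K) :=
  ⟨TensorProduct.map₂
      ((LinearMap.mul K A).compl₂ D.toLinearMap - (LinearMap.mul K A).comp D.toLinearMap) W.chi,
    alternating_of_tmul _
      (fun a b x y => by
        change (a * D b - D a * b) ⊗ₜ[K] W.chi x y + (b * D a - D b * a) ⊗ₜ[K] W.chi y x = 0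
        rw [W.chi_symm y x, ← TensorProduct.add_tmul, mul_comm b, mul_comm a]
        simp)
      (fun a x => by
        change (a * D a - D a * a) ⊗ₜ[K] W.chi x x = 0
        rw [mul_comm a, sub_self, TensorProduct.zero_tmul])⟩

lemma Phi_tmul (D : Derivation K A A) (a b : A) (x y : W p K) :
    Phi p D (a ⊗ₜ x) (b ⊗ₜ y) = (a * D b - D a * b) ⊗ₜ[K] W.chi x y := rfl

/-- The 1-cochain `1 ⊗ D` with `x ⊗ a ↦ x ⊗ D(a)`. -/
def oneTensor (L : Type*) [LieRing L] [LieAlgebra K L] (D : Derivation K A A) :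
    oneCochain K (A ⊗[K] L) (A ⊗[K] L) :=
  LinearMap.rTensor L D.toLinearMap

lemma oneTensor_tmul [LieRing L] [LieAlgebra K L] (D : Derivation K A A) (a : A) (x : L) :
    oneTensor L D (a ⊗ₜ x) = D a ⊗ₜ[K] x := rfl

end Current

end CurrentWitt

end

open CurrentWitt LieModule.Cohomology

/-!
The proof works with the basis `E s = x^s ∂` of `W₁(1)`, the derivations of `K[x]/(x^p)`, in which
`⁅E s, E t⁆ = (t - s) E (s + t - 1)`.

The torus element `1 ⊗ x∂` acts on `A ⊗ E s` by the scalar `s - 1` of the prime field, so every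
cocycle is cohomologous to one that is invariant under the torus
(`exists_lieDerivTwo_torus_eq_zero`). An invariant 2-cochain has the form
`(a ⊗ E s, b ⊗ E t) ↦ f(a, b) ⊗ E r` with `r ≡ s + t - 1` modulo `p`, and it splits into parts of
degrees `p`, `0` and `-p` for the `ℤ`-grading, on which the cocycle condition can be treated
separately.

* In degree `p` the only coefficient is at `(E 0, E 0)`, and it gives `Φ_D`
  (`exists_derivation_coeff_zero_zero`).
* In degree `0` the coboundary of a diagonal 1-cochain is used to make the cocycle vanish on the
  pairs `(1 ⊗ E 0, b ⊗ E t)`. Bracketing with `1 ⊗ E 0` then lowers the indices, and all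
  coefficients are expressed by a single bilinear map `P` on `A`: the one at `(E t, E u)` is
  `u P(a, b) - t P(b, a)` (`coeff_eq_of_normalized`). Here `P(a, b) = b D(a) + F(a, b)` with a
  derivation `D` and a Harrison cocycle `F`, which gives `Ψ_D + Υ_F`
  (`exists_derivation_harrisonCocycle`).
* In degree `-p` the coefficients with target `E 0` are first shown to be `A`-bilinear
  (`coeff_line`). The remaining scalars satisfy a recursion in `t`, and its skew-symmetric
  solutions are the multiples of `t - u` (`coeff_line_values`). The other targets follow by
  lowering indices, and the result is `Θ_{φ,v}` (`exists_coeff_neg_eq`).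

Conversely the parameters `v`, `D` and `E` are read off from coefficients of a combination of the
standard cocycles at which all coboundaries vanish, and `F` from a coefficient at which the
coboundaries are Harrison coboundaries up to terms that can be removed
(`eq_zero_of_normalForm_coboundary`).
The case `A = K` shows that `H²(W₁(1), W₁(1))` is spanned by the class of `φ`
(`exists_smul_phi`), so that each element of `H²(W₁(1), W₁(1)) ⊗ A` is `[φ] ⊗ u` for some `u`.
The first cohomology is obtained in the same way, from the diagonal 1-cocycles.
-/

namespace CurrentWitt

/-! ### The basis `x^s ∂` of the Witt algebra -/

namespace W

variable {p : ℕ} {K : Type*} [Field K]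

/-- The element `x^s ∂` of `W₁(1)`, that is `s! e_{s-1}` for `s < p`, and `0` for `p ≤ s`. -/
noncomputable def E (p : ℕ) (K : Type*) [Field K] (s : ℕ) : W p K := (s.factorial : K) • e p K s

lemma E_of_le {s : ℕ} (h : p ≤ s) : E p K s = 0 := by
  simp [E, e, not_lt.2 h]

lemma factorial_cast_ne_zero [Fact p.Prime] [CharP K p] {s : ℕ} (h : s < p) :
    (s.factorial : K) ≠ 0 := by
  rw [Ne, CharP.cast_eq_zero_iff K p, Nat.Prime.dvd_factorial Fact.out]
  omega

lemma bilin_E (c : ℕ → ℕ → W p K) {s t : ℕ} (hs : s < p) (ht : t < p) :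
    bilin c (E p K s) (E p K t) = ((s.factorial * t.factorial : ℕ) : K) • c s t := by
  simp only [E, map_smul, LinearMap.smul_apply, bilin_e c hs ht, smul_smul]
  push_cast
  rw [mul_comm]

lemma choose_mul_factorials (s t : ℕ) :
    (s + t - 1).choose s * (s.factorial * t.factorial) = t * (s + t - 1).factorial ∨
      s + t = 0 := by
  rcases t with _ | t
  · rcases s with _ | s
    · simp
    · simp
  · left
    have := Nat.choose_mul_factorial_mul_factorial (show s ≤ s + t by omega)
    rw [show s + t - s = t by omega] at this
    rw [show s + (t + 1) - 1 = s + t by omega, ← this, Nat.factorial_succ]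
    ring

lemma N_mul_factorials (s t : ℕ) :
    N s t * (s.factorial * t.factorial) = ((t : ℤ) - s) * (s + t - 1).factorial := by
  rcases choose_mul_factorials s t with h | h
  · rcases choose_mul_factorials t s with h' | h'
    · rw [add_comm t s] at h'
      zify at h h'
      rw [N]
      linear_combination h - h'
    · obtain ⟨rfl, rfl⟩ : t = 0 ∧ s = 0 := by omega
      simp [N]
  · obtain ⟨rfl, rfl⟩ : s = 0 ∧ t = 0 := by omega
    simp [N]

/-- The bracket in the basis `E`. It holds for all `s` and `t`: the index `0 + 0 - 1` is harmless
since its coefficient vanishes, and so do both sides if `s` or `t` is at least `p`. -/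
lemma lie_E [Fact p.Prime] [CharP K p] (s t : ℕ) :
    ⁅E p K s, E p K t⁆ = ((t : K) - s) • E p K (s + t - 1) := by
  have hp := (Fact.out : p.Prime).pos
  by_cases hs : s < p
  · by_cases ht : t < p
    · rw [lie_def, bracket, bilin_E _ hs ht, smul_smul, E, smul_smul]
      congr 1
      have := congrArg (Int.cast : ℤ → K) (N_mul_factorials s t)
      push_cast at this ⊢
      rw [← this, mul_comm]
    · rw [E_of_le (not_lt.1 ht), lie_zero]
      by_cases h : p ≤ s + t - 1
      · rw [E_of_le h, smul_zero]
      · obtain ⟨rfl, rfl⟩ : s = 0 ∧ t = p := by omega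
        simp
  · rw [E_of_le (not_lt.1 hs), zero_lie]
    by_cases h : p ≤ s + t - 1
    · rw [E_of_le h, smul_zero]
    · obtain ⟨rfl, rfl⟩ : s = p ∧ t = 0 := by omega
      simp

lemma psi_E {s t : ℕ} (hs : s < p) (ht : t < p) :
    psi (E p K s) (E p K t) = (t : K) • E p K (s + t - 1) := by
  rw [psi, bilin_E _ hs ht]
  rcases choose_mul_factorials s t with h | h
  · split_ifs with h1
    · rw [smul_smul, E, smul_smul]
      congr 1
      have := congrArg (Nat.cast : ℕ → K) h
      push_cast at this ⊢
      rw [← this, mul_comm]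
    · obtain ⟨rfl, rfl⟩ : s = 0 ∧ t = 0 := by omega
      simp
  · obtain ⟨rfl, rfl⟩ : s = 0 ∧ t = 0 := by omega
    simp

lemma factorial_pred_cast [Fact p.Prime] [CharP K p] : ((p - 1).factorial : K) = -1 := by
  have := congrArg (ZMod.castHom dvd_rfl K) (ZMod.wilsons_lemma p)
  rwa [map_natCast, map_neg, map_one] at this

lemma chi_E [Fact p.Prime] [CharP K p] {s t : ℕ} (hs : s < p) (ht : t < p) :
    chi (E p K s) (E p K t) = if s = 0 ∧ t = 0 then -E p K (p - 1) else 0 := by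
  rw [chi, bilin_E _ hs ht]
  split_ifs with h
  · obtain ⟨rfl, rfl⟩ := h
    simp [E, factorial_pred_cast]
  · simp

/-- The quotient `(p + k)! / p` is `(p - 1)! (p + 1) ⋯ (p + k)`, so it is `-k!` modulo `p` by
Wilson's theorem. -/
lemma factorial_div_cast [Fact p.Prime] [CharP K p] (k : ℕ) :
    ∃ q : ℕ, (p + k).factorial = p * q ∧ (q : K) = -(k.factorial : K) := by
  refine ⟨(p - 1).factorial * (p + 1).ascFactorial k, ?_, ?_⟩
  · rw [← Nat.factorial_mul_ascFactorial, ← mul_assoc,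
      Nat.mul_factorial_pred (Fact.out : p.Prime).ne_zero]
  · have : ((p + 1).ascFactorial k : K) = k.factorial := by
      induction k with
      | zero => simp
      | succ k ih =>
        rw [Nat.ascFactorial_succ, Nat.factorial_succ]
        push_cast
        rw [ih, CharP.cast_eq_zero K p]
        ring
    rw [Nat.cast_mul, factorial_pred_cast, this, neg_one_mul]

lemma phi_E [Fact p.Prime] [CharP K p] {s t : ℕ} (hs : s < p) (ht : t < p) :
    phi p K (E p K s) (E p K t) =
      if p + 1 ≤ s + t then ((s : K) - t) • E p K (s + t - 1 - p) else 0 := by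
  have h0 : ∀ x y : W p K, phi p K x y = bilin (fun s t => if p + 1 ≤ s + t then
      ((N s t / p : ℤ) : K) • e p K (s + t - 1 - p) else 0) x y := fun _ _ => rfl
  rw [h0, bilin_E _ hs ht]
  split_ifs with h
  · rw [smul_smul, E, smul_smul]
    congr 1
    obtain ⟨q, hq, hqK⟩ := factorial_div_cast (p := p) (K := K) (s + t - 1 - p)
    rw [show p + (s + t - 1 - p) = s + t - 1 by omega] at hq
    obtain ⟨r, hr⟩ := dvd_N (Fact.out : p.Prime) hs ht (by omega)
    have hp0 : (p : ℤ) ≠ 0 := by exact_mod_cast (Fact.out : p.Prime).ne_zero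
    have h1 := N_mul_factorials s t
    rw [hr, hq] at h1
    have h2 : r * (s.factorial * t.factorial) = ((t : ℤ) - s) * q := by
      apply mul_left_cancel₀ hp0
      push_cast at h1
      linear_combination h1
    rw [hr, Int.mul_ediv_cancel_left _ hp0]
    have h3 := congrArg (Int.cast : ℤ → K) h2
    push_cast at h3 ⊢
    rw [hqK] at h3
    linear_combination h3
  · simp

/-- The linear form on `W₁(1)` with `E r ↦ 1` that vanishes on the other `E s`. -/
noncomputable def coordE (p : ℕ) (K : Type*) [Field K] (r : ℕ) : W p K →ₗ[K] K :=
  (basis p K).constr K fun s => if (s : ℕ) = r then (r.factorial : K)⁻¹ else 0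

lemma coordE_E [Fact p.Prime] [CharP K p] {r : ℕ} (hr : r < p) (s : ℕ) :
    coordE p K r (E p K s) = if s = r then 1 else 0 := by
  by_cases hs : s < p
  · simp only [E, e, hs, dif_pos, map_smul, coordE, Module.Basis.constr_basis]
    split_ifs with h
    · subst h
      simp [factorial_cast_ne_zero hr]
    · simp
  · rw [E_of_le (not_lt.1 hs), map_zero, if_neg (by omega)]

lemma sum_coordE [Fact p.Prime] [CharP K p] (x : W p K) :
    ∑ r ∈ Finset.range p, coordE p K r x • E p K r = x := by
  have : (∑ r ∈ Finset.range p, (coordE p K r).smulRight (E p K r)) = LinearMap.id := by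
    refine (basis p K).ext fun s => ?_
    simp only [LinearMap.sum_apply, LinearMap.smulRight_apply, coordE, Module.Basis.constr_basis,
      LinearMap.id_apply]
    rw [Finset.sum_eq_single (s : ℕ)]
    · rw [if_pos rfl, E, smul_smul, inv_mul_cancel₀ (factorial_cast_ne_zero s.2), one_smul, e_coe]
    · intro r _ hr
      rw [if_neg (Ne.symm hr), zero_smul]
    · intro h
      exact absurd (Finset.mem_range.2 s.2) h
  simpa using LinearMap.congr_fun this x

end W

/-! ### Homogeneous elements of the current algebra -/

section Current

variable {p : ℕ} {K A : Type*} [Field K] [CommRing A] [Algebra K A]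

/-- The linear map `a ↦ a ⊗ E s` from `A` to `A ⊗ W₁(1)`. -/
noncomputable def mon (p : ℕ) (K : Type*) {A : Type*} [Field K] [CommRing A] [Algebra K A] (s : ℕ) :
    A →ₗ[K] A ⊗[K] W p K :=
  (TensorProduct.mk K A (W p K)).flip (W.E p K s)

lemma mon_apply (s : ℕ) (a : A) : mon p K s a = a ⊗ₜ[K] W.E p K s := rfl

lemma mon_of_le {s : ℕ} (h : p ≤ s) (a : A) : mon p K s a = 0 := by
  rw [mon_apply, W.E_of_le h, TensorProduct.tmul_zero]

lemma mon_eq_zero (s : ℕ) {x : A} (h : x = 0) : mon p K s x = 0 := by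
  rw [h, map_zero]

lemma smul_tmul_E (k : K) (s : ℕ) (a : A) :
    a ⊗ₜ[K] (k • W.E p K s) = mon p K s (algebraMap K A k * a) := by
  rw [mon_apply, ← TensorProduct.smul_tmul, Algebra.smul_def]

/-- The coefficient of `E r` of an element of `A ⊗ W₁(1)`. -/
noncomputable def coord (p : ℕ) (K : Type*) {A : Type*} [Field K] [CommRing A] [Algebra K A]
    (r : ℕ) : A ⊗[K] W p K →ₗ[K] A :=
  (TensorProduct.rid K A).toLinearMap ∘ₗ (W.coordE p K r).lTensor A

variable [Fact p.Prime] [CharP K p]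

lemma cast_prime_eq_zero (p : ℕ) (K : Type*) (A : Type*) [Field K] [CommRing A] [Algebra K A]
    [CharP K p] : (p : A) = 0 := by
  rw [← map_natCast (algebraMap K A), CharP.cast_eq_zero, map_zero]

lemma isUnit_natCast (p : ℕ) (K : Type*) {A : Type*} [Field K] [CommRing A] [Algebra K A]
    [Fact p.Prime] [CharP K p] {n : ℕ} (h0 : 0 < n) (h : n < p) : IsUnit (n : A) := by
  rw [← map_natCast (algebraMap K A)]
  refine (IsUnit.mk0 _ ?_).map _
  rw [Ne, CharP.cast_eq_zero_iff K p]
  exact fun hd => absurd (Nat.le_of_dvd h0 hd) (by omega)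

lemma coord_mon {r : ℕ} (hr : r < p) (s : ℕ) (a : A) :
    coord p K r (mon p K s a) = if s = r then a else 0 := by
  simp only [coord, mon_apply, LinearMap.comp_apply, LinearMap.lTensor_tmul, W.coordE_E hr,
    LinearEquiv.coe_coe, TensorProduct.rid_tmul]
  split_ifs <;> simp

lemma coord_mon_self {r : ℕ} (hr : r < p) (a : A) : coord p K r (mon p K r a) = a := by
  rw [coord_mon hr, if_pos rfl]

lemma sum_mon_coord (z : A ⊗[K] W p K) :
    ∑ r ∈ Finset.range p, mon p K r (coord p K r z) = z := by
  induction z with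
  | zero => simp
  | add x y hx hy => simp only [map_add, Finset.sum_add_distrib, hx, hy]
  | tmul a x =>
    conv_rhs => rw [← W.sum_coordE x, TensorProduct.tmul_sum]
    refine Finset.sum_congr rfl fun r _ => ?_
    simp [coord, mon_apply]

lemma linearMap_ext_mon {M : Type*} [AddCommGroup M] [Module K M] {f g : A ⊗[K] W p K →ₗ[K] M}
    (h : ∀ s < p, ∀ a, f (mon p K s a) = g (mon p K s a)) : f = g := by
  refine LinearMap.ext fun z => ?_
  rw [← sum_mon_coord z, map_sum, map_sum]
  exact Finset.sum_congr rfl fun r hr => h r (Finset.mem_range.1 hr) _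

lemma lie_mon (s t : ℕ) (a b : A) :
    ⁅mon p K s a, mon p K t b⁆ = mon p K (s + t - 1) (((t : A) - s) * (a * b)) := by
  have : ⁅mon p K s a, mon p K t b⁆ = (a * b) ⊗ₜ[K] ⁅W.E p K s, W.E p K t⁆ := rfl
  rw [this, W.lie_E, smul_tmul_E]
  simp

lemma twoCochain_ext_mon {ω η : twoCochain K (A ⊗[K] W p K) (A ⊗[K] W p K)}
    (h : ∀ s < p, ∀ t < p, ∀ a b,
      ω (mon p K s a) (mon p K t b) = η (mon p K s a) (mon p K t b)) : ω = η := by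
  apply Subtype.ext
  exact linearMap_ext_mon fun s hs a => linearMap_ext_mon fun t ht b => h s hs t ht a b

end Current

/-! ### The cocycle condition -/

section Cocycle

variable {R L : Type*} [CommRing R] [LieRing L] [LieAlgebra R L]

/-- The summand of `d₂₃ ω x y z` whose sum over the cyclic permutations of `(x, y, z)` is
`d₂₃ ω x y z`. -/
def cyclicTerm (ω : twoCochain R L L) (x y z : L) : L := ⁅x, ω y z⁆ - ω ⁅y, z⁆ x

lemma d₂₃_eq_cyclicTerm (ω : twoCochain R L L) (x y z : L) :
    d₂₃ R L L ω x y z = cyclicTerm ω x y z + cyclicTerm ω y z x + cyclicTerm ω z x y := by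
  rw [d₂₃_apply, cyclicTerm, cyclicTerm, cyclicTerm, ← twoCochain_skew ω x z, lie_neg,
    ← lie_skew z x, map_neg, LinearMap.neg_apply]
  abel

lemma cyclicTerm_sum_of_mem {ω : twoCochain R L L} (h : ω ∈ twoCocycle R L L) (x y z : L) :
    cyclicTerm ω x y z + cyclicTerm ω y z x + cyclicTerm ω z x y = 0 := by
  rw [← d₂₃_eq_cyclicTerm, (mem_twoCocycle_iff R L L ω).1 h]
  rfl

end Cocycle

lemma mem_twoCocycle_of_mon {p : ℕ} {K A : Type*} [Field K] [CommRing A] [Algebra K A]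
    [Fact p.Prime] [CharP K p] {ω : twoCochain K (A ⊗[K] W p K) (A ⊗[K] W p K)}
    (h : ∀ s < p, ∀ t < p, ∀ u < p, ∀ a b c,
      cyclicTerm ω (mon p K s a) (mon p K t b) (mon p K u c) +
        cyclicTerm ω (mon p K t b) (mon p K u c) (mon p K s a) +
        cyclicTerm ω (mon p K u c) (mon p K s a) (mon p K t b) = 0) :
    ω ∈ twoCocycle K (A ⊗[K] W p K) (A ⊗[K] W p K) := by
  rw [mem_twoCocycle_iff]
  refine linearMap_ext_mon fun s hs a => linearMap_ext_mon fun t ht b =>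
    linearMap_ext_mon fun u hu c => ?_
  rw [d₂₃_eq_cyclicTerm, h s hs t ht u hu a b c]
  rfl

/-! ### The standard cochains are cocycles -/

section Tensor

variable {K A L : Type*} [Field K] [CommRing A] [Algebra K A] [LieRing L] [LieAlgebra K L]

lemma lie_tmul_tmul (a b : A) (x y : L) : ⁅a ⊗ₜ[K] x, b ⊗ₜ[K] y⁆ = (a * b) ⊗ₜ[K] ⁅x, y⁆ := rfl

lemma twoCochain_ext_tmul {ω η : twoCochain K (A ⊗[K] L) (A ⊗[K] L)}
    (h : ∀ (a b : A) (x y : L), ω (a ⊗ₜ x) (b ⊗ₜ y) = η (a ⊗ₜ x) (b ⊗ₜ y)) : ω = η :=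
  Subtype.ext (TensorProduct.ext' fun a x => TensorProduct.ext' fun b y => h a b x y)

lemma mem_twoCocycle_of_tmul {ω : twoCochain K (A ⊗[K] L) (A ⊗[K] L)}
    (h : ∀ (a b c : A) (x y z : L),
      cyclicTerm ω (a ⊗ₜ x) (b ⊗ₜ y) (c ⊗ₜ z) + cyclicTerm ω (b ⊗ₜ y) (c ⊗ₜ z) (a ⊗ₜ x) +
        cyclicTerm ω (c ⊗ₜ z) (a ⊗ₜ x) (b ⊗ₜ y) = 0) :
    ω ∈ twoCocycle K (A ⊗[K] L) (A ⊗[K] L) := by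
  rw [mem_twoCocycle_iff]
  refine TensorProduct.ext' fun a x => TensorProduct.ext' fun b y =>
    TensorProduct.ext' fun c z => ?_
  rw [d₂₃_eq_cyclicTerm, h]
  rfl

lemma oneTensor_mem (D : Derivation K A A) :
    oneTensor L D ∈ oneCocycle K (A ⊗[K] L) := by
  rw [oneCocycle, LinearMap.mem_ker]
  refine twoCochain_ext_tmul fun a b x y => ?_
  rw [d₁₂_apply_apply, lie_tmul_tmul, oneTensor_tmul, oneTensor_tmul, oneTensor_tmul,
    lie_tmul_tmul, lie_tmul_tmul, ← lie_skew x y, D.leibniz, smul_eq_mul, smul_eq_mul,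
    TensorProduct.add_tmul, TensorProduct.tmul_neg, TensorProduct.tmul_neg]
  change _ = (0 : A ⊗[K] L)
  abel

lemma Theta_mem (φ : twoCocycle K L L) (u : A) :
    Theta φ.1 u ∈ twoCocycle K (A ⊗[K] L) (A ⊗[K] L) := by
  have key : ∀ (a b c : A) (x y z : L), cyclicTerm (Theta φ.1 u) (a ⊗ₜ x) (b ⊗ₜ y) (c ⊗ₜ z) =
      (a * b * c * u) ⊗ₜ[K] cyclicTerm φ.1 x y z := by
    intro a b c x y z
    rw [cyclicTerm, cyclicTerm, Theta_tmul, lie_tmul_tmul, lie_tmul_tmul, Theta_tmul,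
      TensorProduct.tmul_sub]
    congr 2 <;> ring
  refine mem_twoCocycle_of_tmul fun a b c x y z => ?_
  rw [key, key, key, show b * c * a * u = a * b * c * u by ring,
    show c * a * b * u = a * b * c * u by ring, ← TensorProduct.tmul_add, ← TensorProduct.tmul_add,
    cyclicTerm_sum_of_mem φ.2, TensorProduct.tmul_zero]

lemma Upsilon_mem (F : harrisonCocycle K A) :
    Upsilon L F ∈ twoCocycle K (A ⊗[K] L) (A ⊗[K] L) := by
  have key : ∀ (a b c : A) (x y z : L), cyclicTerm (Upsilon L F) (a ⊗ₜ x) (b ⊗ₜ y) (c ⊗ₜ z) =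
      (a * F.1 b c + F.1 a (b * c)) ⊗ₜ[K] ⁅x, ⁅y, z⁆⁆ := by
    intro a b c x y z
    rw [cyclicTerm, lie_tmul_tmul, Upsilon_tmul, Upsilon_tmul, lie_tmul_tmul,
      ← lie_skew x ⁅y, z⁆, TensorProduct.add_tmul, F.2.1 (b * c) a]
    simp only [TensorProduct.tmul_neg]
    abel
  -- The Harrison condition says that this coefficient is invariant under cyclic permutations.
  have cyc : ∀ a b c : A, b * F.1 c a + F.1 b (c * a) = a * F.1 b c + F.1 a (b * c) := by
    intro a b c
    have h := F.2.2 b c a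
    rw [F.2.1 (b * c) a] at h
    linear_combination h
  refine mem_twoCocycle_of_tmul fun a b c x y z => ?_
  rw [key, key, key, cyc b c a, cyc a b c, ← TensorProduct.tmul_add, ← TensorProduct.tmul_add,
    lie_jacobi, TensorProduct.tmul_zero]

lemma Theta_d₁₂ (g : oneCochain K L L) (u : A) :
    Theta (d₁₂ K L L g) u =
      d₁₂ K (A ⊗[K] L) (A ⊗[K] L) (TensorProduct.map (LinearMap.mulRight K u) g) := by
  refine twoCochain_ext_tmul fun a b x y => ?_
  rw [Theta_tmul, d₁₂_apply_apply, d₁₂_apply_apply, lie_tmul_tmul, TensorProduct.map_tmul,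
    TensorProduct.map_tmul, TensorProduct.map_tmul, lie_tmul_tmul, lie_tmul_tmul]
  simp only [LinearMap.mulRight_apply]
  rw [← mul_assoc, ← mul_assoc, mul_comm b a, TensorProduct.tmul_sub, TensorProduct.tmul_sub]

lemma Upsilon_harrisonDelta (F : harrisonCocycle K A) (G : A →ₗ[K] A)
    (h : harrisonDelta K A G = F.1) :
    Upsilon L F = d₁₂ K (A ⊗[K] L) (A ⊗[K] L) (G.rTensor L) := by
  refine twoCochain_ext_tmul fun a b x y => ?_
  have hF : F.1 a b = a * G b + b * G a - G (a * b) := by rw [← h]; rfl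
  rw [Upsilon_tmul, d₁₂_apply_apply, lie_tmul_tmul, LinearMap.rTensor_tmul,
    LinearMap.rTensor_tmul, LinearMap.rTensor_tmul, lie_tmul_tmul, lie_tmul_tmul, hF,
    ← lie_skew x y]
  simp only [TensorProduct.sub_tmul, TensorProduct.add_tmul, TensorProduct.tmul_neg]
  abel

end Tensor

section Mon

variable {p : ℕ} [Fact p.Prime] {K A : Type*} [Field K] [CharP K p] [CommRing A] [Algebra K A]

/-- The cochain `φ` is the first-order part of the deformation `x ^ p = ε` of the truncated
polynomial ring. Thus the two cases `t + u ≤ p` and `p < t + u`, in each of which one of the two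
parts of the cyclic term vanishes, give the same expression. -/
lemma W.cyclicTerm_phi {s t u : ℕ} (hs : s < p) (ht : t < p) (hu : u < p) :
    cyclicTerm (W.phi p K) (W.E p K s) (W.E p K t) (W.E p K u) =
      if p + 2 ≤ s + t + u then
        (((t : K) - u) * ((t : K) + u - 1 - s)) • W.E p K (s + t + u - 2 - p) else 0 := by
  have zero : (p : K) = 0 := CharP.cast_eq_zero K p
  rw [cyclicTerm, W.phi_E ht hu, W.lie_E, map_smul, LinearMap.smul_apply]
  by_cases h : p + 1 ≤ t + u
  · rw [if_pos h, W.E_of_le (show p ≤ t + u - 1 by omega), map_zero, LinearMap.zero_apply,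
      smul_zero, sub_zero, lie_smul, W.lie_E, smul_smul, Nat.cast_sub (by omega),
      Nat.cast_sub (by omega)]
    push_cast
    rw [zero]
    by_cases h2 : p + 2 ≤ s + t + u
    · rw [if_pos h2, show s + (t + u - 1 - p) - 1 = s + t + u - 2 - p by omega]
      ring_nf
    · obtain ⟨rfl, h3⟩ : s = 0 ∧ t + u = p + 1 := by omega
      have h4 : (t : K) + u = 1 := by
        exact_mod_cast (congrArg (Nat.cast : ℕ → K) h3).trans (by simp)
      simp [h4]
  · rw [if_neg h, lie_zero, zero_sub]
    by_cases h0 : t + u = 0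
    · obtain ⟨rfl, rfl⟩ : t = 0 ∧ u = 0 := by omega
      simp
    · rw [W.phi_E (by omega) hs, Nat.cast_sub (by omega)]
      by_cases h2 : p + 2 ≤ s + t + u
      · rw [if_pos h2, if_pos (by omega), show t + u - 1 + s - 1 - p = s + t + u - 2 - p by omega,
          smul_smul, ← neg_smul]
        push_cast
        ring_nf
      · rw [if_neg h2, if_neg (by omega), smul_zero, neg_zero]

lemma W.linearMap_ext_E {M : Type*} [AddCommGroup M] [Module K M] {f g : W p K →ₗ[K] M}
    (h : ∀ s < p, f (W.E p K s) = g (W.E p K s)) : f = g := by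
  refine LinearMap.ext fun z => ?_
  rw [← W.sum_coordE z, map_sum, map_sum]
  exact Finset.sum_congr rfl fun r hr => by rw [map_smul, map_smul, h r (Finset.mem_range.1 hr)]

lemma W.phi_mem : W.phi p K ∈ twoCocycle K (W p K) (W p K) := by
  rw [mem_twoCocycle_iff]
  refine W.linearMap_ext_E fun s hs => W.linearMap_ext_E fun t ht =>
    W.linearMap_ext_E fun u hu => ?_
  change _ = (0 : W p K)
  rw [d₂₃_eq_cyclicTerm, W.cyclicTerm_phi hs ht hu, W.cyclicTerm_phi ht hu hs,
    W.cyclicTerm_phi hu hs ht, show t + u + s = s + t + u by omega,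
    show u + s + t = s + t + u by omega]
  split_ifs
  · rw [← add_smul, ← add_smul]
    convert zero_smul K _ using 2
    ring
  · simp

lemma Psi_mon (D : Derivation K A A) {s t : ℕ} (hs : s < p) (ht : t < p) (a b : A) :
    Psi p D (mon p K s a) (mon p K t b) =
      mon p K (s + t - 1) (t * (b * D a) - s * (a * D b)) := by
  rw [mon_apply, mon_apply, Psi_tmul, W.psi_E hs ht, W.psi_E ht hs, smul_tmul_E, smul_tmul_E,
    add_comm t s, ← map_sub]
  simp only [map_natCast]
  ring_nf

lemma Phi_mon (D : Derivation K A A) {s t : ℕ} (hs : s < p) (ht : t < p) (a b : A) :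
    Phi p D (mon p K s a) (mon p K t b) =
      if s = 0 ∧ t = 0 then mon p K (p - 1) (b * D a - a * D b) else 0 := by
  rw [mon_apply, mon_apply, Phi_tmul, W.chi_E hs ht]
  split_ifs
  · rw [TensorProduct.tmul_neg, ← TensorProduct.neg_tmul, mon_apply]
    ring_nf
  · simp

lemma Theta_phi_mon (v : A) {s t : ℕ} (hs : s < p) (ht : t < p) (a b : A) :
    Theta (W.phi p K) v (mon p K s a) (mon p K t b) =
      if p + 1 ≤ s + t then mon p K (s + t - 1 - p) (((s : A) - t) * (a * b * v)) else 0 := by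
  rw [mon_apply, mon_apply, Theta_tmul, W.phi_E hs ht]
  split_ifs
  · rw [smul_tmul_E]
    simp
  · simp

lemma Upsilon_mon (F : harrisonCocycle K A) (s t : ℕ) (a b : A) :
    Upsilon (W p K) F (mon p K s a) (mon p K t b) =
      mon p K (s + t - 1) (((t : A) - s) * F.1 a b) := by
  rw [mon_apply, mon_apply, Upsilon_tmul, W.lie_E, smul_tmul_E]
  simp

lemma cyclicTerm_Psi (D : Derivation K A A) {s t u : ℕ} (hs : s < p) (ht : t < p) (hu : u < p)
    (a b c : A) :
    cyclicTerm (Psi p D) (mon p K s a) (mon p K t b) (mon p K u c) =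
      mon p K (s + t + u - 2) (((t : A) + u - 1 - s) * (a * (u * (c * D b) - t * (b * D c))) -
        ((u : A) - t) * (s * (a * D (b * c)) - ((t : A) + u - 1) * (b * c * D a))) := by
  rw [cyclicTerm, Psi_mon D ht hu, lie_mon, lie_mon]
  by_cases h0 : t + u = 0
  · obtain ⟨rfl, rfl⟩ : t = 0 ∧ u = 0 := by omega
    simp
  by_cases h1 : t + u - 1 < p
  · rw [Psi_mon D h1 hs, show t + u - 1 + s - 1 = s + t + u - 2 by omega,
      show s + (t + u - 1) - 1 = s + t + u - 2 by omega, ← map_sub, Nat.cast_sub (by omega)]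
    have hD : D ((u : A) - t) = 0 := by simp
    rw [D.leibniz, hD]
    congr 1
    push_cast
    simp only [smul_eq_mul]
    ring
  · rw [mon_of_le (show p ≤ t + u - 1 by omega), map_zero, LinearMap.zero_apply, sub_zero]
    by_cases h2 : p ≤ s + t + u - 2
    · rw [mon_of_le h2, mon_of_le (by omega)]
    · obtain ⟨rfl, h3⟩ : s = 0 ∧ t + u = p + 1 := by omega
      have h4 : (t : A) + u = 1 := by
        rw [← Nat.cast_add, h3, Nat.cast_add, cast_prime_eq_zero p K A]; simp
      rw [show 0 + (t + u - 1) - 1 = 0 + t + u - 2 by omega, Nat.cast_sub (by omega)]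
      congr 1
      push_cast
      linear_combination ((t : A) - u) * (b * c * D a) * h4

lemma Psi_mem (D : Derivation K A A) :
    Psi p D ∈ twoCocycle K (A ⊗[K] W p K) (A ⊗[K] W p K) := by
  refine mem_twoCocycle_of_mon fun s hs t ht u hu a b c => ?_
  rw [cyclicTerm_Psi D hs ht hu, cyclicTerm_Psi D ht hu hs, cyclicTerm_Psi D hu hs ht,
    show t + u + s = s + t + u by omega, show u + s + t = s + t + u by omega, ← map_add, ← map_add]
  simp only [D.leibniz, smul_eq_mul]
  refine mon_eq_zero _ ?_
  ring

lemma cyclicTerm_Phi (D : Derivation K A A) {s t u : ℕ} (hs : s < p) (ht : t < p) (hu : u < p)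
    (a b c : A) :
    cyclicTerm (Phi p D) (mon p K s a) (mon p K t b) (mon p K u c) =
      if s + t + u = 0 then -mon p K (p - 2) (a * (c * D b - b * D c)) else
      if s = 1 ∧ t + u = 0 then -mon p K (p - 1) (2 * (a * (c * D b - b * D c))) else
      if s = 0 ∧ t + u = 1 then
        -mon p K (p - 1) (((u : A) - t) * (a * D (b * c) - b * c * D a)) else 0 := by
  have hp := (Fact.out : p.Prime).two_le
  have zero := cast_prime_eq_zero p K A
  rw [cyclicTerm, Phi_mon D ht hu, lie_mon]
  by_cases h0 : t + u = 0
  · obtain ⟨rfl, rfl⟩ : t = 0 ∧ u = 0 := by omega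
    simp only [and_self, if_true, Nat.cast_zero, sub_self, zero_mul, map_zero,
      LinearMap.zero_apply, sub_zero, add_zero]
    rw [lie_mon, Nat.cast_sub (by omega), zero]
    by_cases hs0 : s = 0
    · subst hs0
      rw [if_pos rfl, ← map_neg, show 0 + (p - 1) - 1 = p - 2 by omega]
      congr 1
      push_cast
      ring
    · rw [if_neg hs0]
      by_cases hs1 : s = 1
      · subst hs1
        rw [if_pos ⟨rfl, trivial⟩, ← map_neg, show 1 + (p - 1) - 1 = p - 1 by omega]
        congr 1
        push_cast
        ring
      · rw [if_neg (by simp [hs1]), mon_of_le (by omega), if_neg (by simp)]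
  · rw [if_neg (by omega), lie_zero, zero_sub, if_neg (by omega), if_neg (by omega)]
    by_cases h1 : t + u - 1 < p
    · rw [Phi_mon D h1 hs]
      by_cases h2 : s = 0 ∧ t + u = 1
      · rw [if_pos (by omega), if_pos h2, show D (((u : A) - t) * (b * c)) =
          ((u : A) - t) * D (b * c) by rw [D.leibniz]; simp]
        congr 2
        ring
      · rw [if_neg (by omega), if_neg h2, neg_zero]
    · rw [mon_of_le (by omega), map_zero, LinearMap.zero_apply, neg_zero, if_neg (by omega)]

lemma Phi_mem (D : Derivation K A A) :
    Phi p D ∈ twoCocycle K (A ⊗[K] W p K) (A ⊗[K] W p K) := by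
  refine mem_twoCocycle_of_mon fun s hs t ht u hu a b c => ?_
  rw [cyclicTerm_Phi D hs ht hu, cyclicTerm_Phi D ht hu hs, cyclicTerm_Phi D hu hs ht]
  by_cases h0 : s + t + u = 0
  · rw [if_pos h0, if_pos (by omega), if_pos (by omega), ← map_neg, ← map_neg, ← map_neg,
      ← map_add, ← map_add]
    refine mon_eq_zero _ ?_
    ring
  rw [if_neg h0, if_neg (by omega : ¬ t + u + s = 0), if_neg (by omega : ¬ u + s + t = 0)]
  by_cases h1 : s + t + u = 1
  · have : (s = 1 ∧ t = 0 ∧ u = 0) ∨ (s = 0 ∧ t = 1 ∧ u = 0) ∨ (s = 0 ∧ t = 0 ∧ u = 1) := by omega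
    rcases this with ⟨rfl, rfl, rfl⟩ | ⟨rfl, rfl, rfl⟩ | ⟨rfl, rfl, rfl⟩ <;>
    · simp only [one_ne_zero, zero_ne_one, and_true, and_false, if_true, if_false, add_zero,
        zero_add, ← map_neg, ← map_add, Nat.cast_zero, Nat.cast_one, D.leibniz, smul_eq_mul]
      refine mon_eq_zero _ ?_
      ring
  · rw [if_neg (by omega), if_neg (by omega), if_neg (by omega), if_neg (by omega),
      if_neg (by omega), if_neg (by omega)]
    simp

end Mon

/-! ### Reduction to cochains invariant under the torus -/

section LieDerivative

variable {R L : Type*} [CommRing R] [LieRing L] [LieAlgebra R L]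

/-- The Lie derivative along `h` on 1-cochains. -/
def lieDerivOne (h : L) : Module.End R (oneCochain R L L) where
  toFun g := LieAlgebra.ad R L h ∘ₗ g - g ∘ₗ LieAlgebra.ad R L h
  map_add' f g := by ext; simp; abel
  map_smul' k g := by ext; simp [smul_sub]

lemma lieDerivOne_apply (h : L) (g : oneCochain R L L) (x : L) :
    lieDerivOne h g x = ⁅h, g x⁆ - g ⁅h, x⁆ := rfl

/-- The Lie derivative along `h` on 2-cochains. -/
def lieDerivTwo (h : L) : Module.End R (twoCochain R L L) where
  toFun ω := ⟨ω.1.compr₂ (LieAlgebra.ad R L h) - ω.1 ∘ₗ LieAlgebra.ad R L h -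
      ω.1.compl₂ (LieAlgebra.ad R L h), fun x => by
    change ⁅h, ω x x⁆ - ω ⁅h, x⁆ x - ω x ⁅h, x⁆ = 0
    rw [← twoCochain_skew ω x ⁅h, x⁆, twoCochain_alt, lie_zero]
    abel⟩
  map_add' f g := by
    apply Subtype.ext
    ext
    simp
    abel
  map_smul' k g := by
    apply Subtype.ext
    ext
    simp [smul_sub]

lemma lieDerivTwo_apply (h : L) (ω : twoCochain R L L) (x y : L) :
    lieDerivTwo h ω x y = ⁅h, ω x y⁆ - ω ⁅h, x⁆ y - ω x ⁅h, y⁆ := rfl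

lemma lieDerivTwo_d₁₂ (h : L) (g : oneCochain R L L) :
    lieDerivTwo h (d₁₂ R L L g) = d₁₂ R L L (lieDerivOne h g) := by
  apply Subtype.ext
  ext x y
  simp only [twoCochain_val_apply, lieDerivTwo_apply, d₁₂_apply_apply, lieDerivOne_apply, lie_sub,
    leibniz_lie h, map_add]
  abel

/-- Cartan's formula `L_h ω = d (ι_h ω)` for a 2-cocycle. -/
lemma lieDerivTwo_of_mem (h : L) {ω : twoCochain R L L} (hω : ω ∈ twoCocycle R L L) :
    lieDerivTwo h ω = d₁₂ R L L (ω h) := by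
  apply Subtype.ext
  ext x y
  simp only [twoCochain_val_apply, lieDerivTwo_apply, d₁₂_apply_apply]
  have := cyclicTerm_sum_of_mem hω h x y
  simp only [cyclicTerm] at this
  rw [← twoCochain_skew ω h y, ← twoCochain_skew ω h ⁅x, y⁆, ← twoCochain_skew ω x ⁅y, h⁆,
    ← lie_skew y h, map_neg, lie_neg] at this
  rw [← sub_eq_zero, ← this]
  abel

lemma lieDerivOne_of_mem (h : L) {g : oneCochain R L L} (hg : g ∈ oneCocycle R L) :
    lieDerivOne h g = LieAlgebra.ad R L (-g h) := by
  ext x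
  have : d₁₂ R L L g h x = 0 := by
    rw [oneCocycle, LinearMap.mem_ker] at hg
    rw [hg]; rfl
  rw [d₁₂_apply_apply] at this
  rw [lieDerivOne_apply, LieAlgebra.ad_apply, neg_lie, lie_skew, ← sub_eq_zero, ← this]
  abel

lemma lieDerivOne_ad (h z : L) :
    lieDerivOne h (LieAlgebra.ad R L z) = LieAlgebra.ad R L ⁅h, z⁆ := by
  ext x
  rw [lieDerivOne_apply, LieAlgebra.ad_apply, LieAlgebra.ad_apply, LieAlgebra.ad_apply,
    leibniz_lie]
  abel

lemma d₁₂_mem_twoCocycle (g : oneCochain R L L) : d₁₂ R L L g ∈ twoCocycle R L L := by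
  rw [mem_twoCocycle_iff]
  exact LinearMap.congr_fun (d₂₃_comp_d₁₂ R L L) g

lemma d₁₂_ad (z : L) : d₁₂ R L L (LieAlgebra.ad R L z) = 0 := by
  apply Subtype.ext
  refine LinearMap.ext fun x => LinearMap.ext fun y => ?_
  change ⁅x, ⁅z, y⁆⁆ - ⁅y, ⁅z, x⁆⁆ - ⁅z, ⁅x, y⁆⁆ = 0
  rw [leibniz_lie z x y, ← lie_skew y ⁅z, x⁆]
  abel

lemma sub_d₁₂_mem_twoCocycle {ω : twoCochain R L L} (hω : ω ∈ twoCocycle R L L)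
    (g : oneCochain R L L) : ω - d₁₂ R L L g ∈ twoCocycle R L L := by
  have hd := d₁₂_mem_twoCocycle g
  rw [mem_twoCocycle_iff] at hω hd ⊢
  refine (map_sub (d₂₃ R L L) ω (d₁₂ R L L g)).trans ?_
  rw [hω, hd, sub_self]

/-- On eigenvectors `x`, `y` of `ad h`, powers of the Lie derivative become powers of a shift of
`ad h`. -/
lemma lieDerivTwo_pow_apply (h x y : L) (k l : R) (hx : ⁅h, x⁆ = k • x) (hy : ⁅h, y⁆ = l • y)
    (n : ℕ) (ω : twoCochain R L L) :
    (lieDerivTwo h ^ n) ω x y =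
      ((LieAlgebra.ad R L h - algebraMap R (Module.End R L) (k + l)) ^ n) (ω x y) := by
  induction n generalizing ω with
  | zero => rfl
  | succ n ih =>
    rw [pow_succ, pow_succ, Module.End.mul_apply, ih, Module.End.mul_apply, lieDerivTwo_apply, hx,
      hy, map_smul, map_smul, LinearMap.smul_apply, LinearMap.sub_apply, LieAlgebra.ad_apply,
      Module.algebraMap_end_apply, add_smul, sub_sub]

lemma lieDerivOne_pow_apply (h x : L) (k : R) (hx : ⁅h, x⁆ = k • x)
    (n : ℕ) (g : oneCochain R L L) :
    (lieDerivOne h ^ n) g x =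
      ((LieAlgebra.ad R L h - algebraMap R (Module.End R L) k) ^ n) (g x) := by
  induction n generalizing g with
  | zero => rfl
  | succ n ih =>
    rw [pow_succ, pow_succ, Module.End.mul_apply, ih, Module.End.mul_apply, lieDerivOne_apply, hx,
      map_smul, LinearMap.sub_apply, LieAlgebra.ad_apply, Module.algebraMap_end_apply]

end LieDerivative

section Torus

variable {p : ℕ} [Fact p.Prime] {K A : Type*} [Field K] [CharP K p] [CommRing A] [Algebra K A]

lemma coord_mon_of_lt (r : ℕ) {s : ℕ} (hs : s < p) (a : A) :
    coord p K r (mon p K s a) = if s = r then a else 0 := by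
  by_cases hr : r < p
  · exact coord_mon hr s a
  · have : W.coordE p K r = 0 := by
      refine (W.basis p K).ext fun t => ?_
      rw [W.coordE, Module.Basis.constr_basis, if_neg (by omega), LinearMap.zero_apply]
    rw [if_neg (by omega), coord, this]
    simp

/-- The torus element `1 ⊗ x∂`. It acts on `A ⊗ E s` as multiplication by `s - 1`. -/
noncomputable def torus (p : ℕ) (K A : Type*) [Field K] [CommRing A] [Algebra K A] :
    A ⊗[K] W p K := mon p K 1 1

lemma lie_torus_mon (s : ℕ) (a : A) :
    ⁅torus p K A, mon p K s a⁆ = ((s : K) - 1) • mon p K s a := by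
  rw [torus, lie_mon, ← map_smul, Algebra.smul_def]
  simp

/-- The eigenvalues of the torus are in the prime field, hence so are those of its shifts by
integers. -/
lemma ad_torus_sub_pow (n : ℤ) :
    (LieAlgebra.ad K _ (torus p K A) - algebraMap K (Module.End K (A ⊗[K] W p K)) n) ^ p =
      LieAlgebra.ad K _ (torus p K A) - algebraMap K (Module.End K (A ⊗[K] W p K)) n := by
  have frob : ∀ m : ℤ, (m : K) ^ p = m := fun m => by
    have := congrArg (ZMod.castHom dvd_rfl K) (ZMod.pow_card (m : ZMod p))
    rwa [map_pow, map_intCast] at this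
  refine linearMap_ext_mon fun s _ a => ?_
  have h1 : (LieAlgebra.ad K _ (torus p K A) - algebraMap K (Module.End K (A ⊗[K] W p K)) n)
      (mon p K s a) = (((s : ℤ) - 1 - n : ℤ) : K) • mon p K s a := by
    rw [LinearMap.sub_apply, LieAlgebra.ad_apply, lie_torus_mon, Module.algebraMap_end_apply]
    push_cast
    module
  have h2 : ∀ m : ℕ, ((LieAlgebra.ad K _ (torus p K A) -
      algebraMap K (Module.End K (A ⊗[K] W p K)) n) ^ m) (mon p K s a) =
        (((s : ℤ) - 1 - n : ℤ) : K) ^ m • mon p K s a := by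
    intro m
    induction m with
    | zero => simp
    | succ m ih => rw [pow_succ, Module.End.mul_apply, h1, map_smul, ih, smul_smul, pow_succ']
  rw [h2, h1, frob]

lemma lieDerivOne_torus_pow :
    (lieDerivOne (torus p K A) : Module.End K _) ^ p = lieDerivOne (torus p K A) := by
  refine LinearMap.ext fun g => linearMap_ext_mon fun s _ a => ?_
  have h1 := lieDerivOne_pow_apply (torus p K A) _ _ (lie_torus_mon s a) 1 g
  rw [pow_one, pow_one] at h1
  rw [lieDerivOne_pow_apply _ _ _ (lie_torus_mon s a), h1,
    show (s : K) - 1 = ((s - 1 : ℤ) : K) by push_cast; rfl, ad_torus_sub_pow]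

lemma lieDerivTwo_torus_pow :
    (lieDerivTwo (torus p K A) : Module.End K _) ^ p = lieDerivTwo (torus p K A) := by
  refine LinearMap.ext fun ω => twoCochain_ext_mon fun s _ t _ a b => ?_
  have h1 := lieDerivTwo_pow_apply (torus p K A) _ _ _ _ (lie_torus_mon s a) (lie_torus_mon t b) 1 ω
  rw [pow_one, pow_one] at h1
  rw [lieDerivTwo_pow_apply _ _ _ _ _ (lie_torus_mon s a) (lie_torus_mon t b), h1,
    show (s : K) - 1 + (t - 1) = ((s - 1 + (t - 1) : ℤ) : K) by push_cast; rfl, ad_torus_sub_pow]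

/-- Every 1-cocycle is torus-invariant up to an inner derivation. -/
lemma exists_lieDerivOne_torus_eq_zero {g : oneCochain K (A ⊗[K] W p K) (A ⊗[K] W p K)}
    (hg : g ∈ oneCocycle K (A ⊗[K] W p K)) :
    ∃ z, lieDerivOne (torus p K A) (g - LieAlgebra.ad K _ z) = 0 := by
  obtain ⟨q, hq⟩ : ∃ q, p = q + 2 := ⟨p - 2, by have := (Fact.out : p.Prime).two_le; omega⟩
  have hpow : ∀ (n : ℕ) (z : A ⊗[K] W p K), ∃ w,
      (lieDerivOne (torus p K A) ^ n : Module.End K _) (LieAlgebra.ad K _ z) =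
        LieAlgebra.ad K _ w := by
    intro n
    induction n with
    | zero => exact fun z => ⟨z, rfl⟩
    | succ n ih =>
      intro z
      obtain ⟨w, hw⟩ := ih ⁅torus p K A, z⁆
      exact ⟨w, by rw [pow_succ, Module.End.mul_apply, lieDerivOne_ad, hw]⟩
  obtain ⟨w, hw⟩ := hpow q (-g (torus p K A))
  refine ⟨w, ?_⟩
  rw [← hw, ← lieDerivOne_of_mem _ hg, ← Module.End.mul_apply, ← pow_succ, map_sub,
    ← Module.End.mul_apply, ← pow_succ']
  have := lieDerivOne_torus_pow (p := p) (K := K) (A := A)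
  rw [show q + 1 + 1 = p by omega, this, sub_self]

/-- Every 2-cocycle is torus-invariant up to a coboundary. The Lie derivative `T` along the torus
satisfies `T ^ p = T`, so `1 - T ^ (p - 1)` is a projection to the invariants; on cocycles `T` takes
values in coboundaries. -/
lemma exists_lieDerivTwo_torus_eq_zero {ω : twoCochain K (A ⊗[K] W p K) (A ⊗[K] W p K)}
    (hω : ω ∈ twoCocycle K (A ⊗[K] W p K) (A ⊗[K] W p K)) :
    ∃ g, lieDerivTwo (torus p K A) (ω - d₁₂ K _ _ g) = 0 := by
  obtain ⟨q, hq⟩ : ∃ q, p = q + 2 := ⟨p - 2, by have := (Fact.out : p.Prime).two_le; omega⟩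
  have hpow : ∀ (n : ℕ) (g : oneCochain K (A ⊗[K] W p K) (A ⊗[K] W p K)),
      (lieDerivTwo (torus p K A) ^ n : Module.End K _) (d₁₂ K _ _ g) =
        d₁₂ K _ _ ((lieDerivOne (torus p K A) ^ n : Module.End K _) g) := by
    intro n
    induction n with
    | zero => exact fun z => rfl
    | succ n ih =>
      intro g
      rw [pow_succ, pow_succ, Module.End.mul_apply, Module.End.mul_apply, lieDerivTwo_d₁₂, ih]
  refine ⟨(lieDerivOne (torus p K A) ^ q : Module.End K _) (ω (torus p K A)), ?_⟩
  rw [← hpow, ← lieDerivTwo_of_mem _ hω, ← Module.End.mul_apply, ← pow_succ]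
  refine (map_sub (lieDerivTwo (torus p K A)) ω _).trans ?_
  rw [← Module.End.mul_apply, ← pow_succ']
  have := lieDerivTwo_torus_pow (p := p) (K := K) (A := A)
  rw [show q + 1 + 1 = p by omega, this, sub_self]

lemma coord_eq_zero_of_lie_torus {z : A ⊗[K] W p K} {n : ℤ}
    (hz : ⁅torus p K A, z⁆ = (n : K) • z) {r : ℕ} (hr : r < p) (h : ¬ (p : ℤ) ∣ r - 1 - n) :
    coord p K r z = 0 := by
  have h1 : coord p K r ⁅torus p K A, z⁆ = ((r : K) - 1) • coord p K r z := by
    rw [← LieAlgebra.ad_apply K]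
    conv_lhs => rw [← sum_mon_coord z]
    simp only [map_sum, LieAlgebra.ad_apply, lie_torus_mon, map_smul, coord_mon hr]
    rw [Finset.sum_eq_single r]
    · rw [if_pos rfl]
    · intro b _ hb
      rw [if_neg hb, smul_zero]
    · intro h
      exact absurd (Finset.mem_range.2 hr) h
  rw [hz, map_smul, ← sub_eq_zero, ← sub_smul] at h1
  refine (smul_eq_zero.1 h1).resolve_left fun h2 => h ?_
  rw [← CharP.intCast_eq_zero_iff K p]
  push_cast
  linear_combination -h2

/-- An eigenvector of the torus is homogeneous. -/
lemma eq_mon_of_lie_torus {z : A ⊗[K] W p K} {n : ℤ} (hz : ⁅torus p K A, z⁆ = (n : K) • z)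
    {r : ℕ} (hr : r < p) (h : (p : ℤ) ∣ r - 1 - n) : z = mon p K r (coord p K r z) := by
  conv_lhs => rw [← sum_mon_coord z]
  refine Finset.sum_eq_single r (fun b hb hbr => ?_) fun h => absurd (Finset.mem_range.2 hr) h
  refine mon_eq_zero _ (coord_eq_zero_of_lie_torus hz (Finset.mem_range.1 hb) fun hd => hbr ?_)
  have h1 : (p : ℤ) ∣ (b : ℤ) - r := by
    obtain ⟨k, hk⟩ := hd
    obtain ⟨l, hl⟩ := h
    exact ⟨k - l, by linear_combination hk - hl⟩
  have h2 := Finset.mem_range.1 hb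
  have h3 := Int.eq_zero_of_abs_lt_dvd h1 (by rw [abs_lt]; omega)
  omega

end Torus

/-! ### The cocycle condition in coordinates -/

section Coordinates

variable {p : ℕ} [Fact p.Prime] {K A : Type*} [Field K] [CharP K p] [CommRing A] [Algebra K A]

lemma coord_lie_mon {n s r : ℕ} (hn : n < p) (h : s + r = n + 1) (a : A) (z : A ⊗[K] W p K) :
    coord p K n ⁅mon p K s a, z⁆ = ((r : A) - s) * (a * coord p K r z) := by
  have : coord p K n ∘ₗ (LieAlgebra.ad K _ (mon p K s a) : Module.End K (A ⊗[K] W p K)) =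
      LinearMap.mulLeft K (((r : A) - s) * a) ∘ₗ coord p K r := by
    refine linearMap_ext_mon fun t ht b => ?_
    simp only [LinearMap.comp_apply, LieAlgebra.ad_apply, lie_mon, coord_mon hn,
      coord_mon_of_lt r ht, LinearMap.mulLeft_apply]
    by_cases htr : t = r
    · subst htr
      rw [if_pos (by omega), if_pos rfl, mul_assoc]
    · rw [if_neg htr, mul_zero]
      split_ifs with h1
      · obtain ⟨rfl, rfl⟩ : s = 0 ∧ t = 0 := by omega
        simp
      · rfl
  simpa [mul_assoc] using LinearMap.congr_fun this z

lemma coord_lie_mon_of_lt {n s : ℕ} (hn : n < p) (h : n + 1 < s) (a : A) (z : A ⊗[K] W p K) :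
    coord p K n ⁅mon p K s a, z⁆ = 0 := by
  have : coord p K n ∘ₗ (LieAlgebra.ad K _ (mon p K s a) : Module.End K (A ⊗[K] W p K)) = 0 := by
    refine linearMap_ext_mon fun t ht b => ?_
    simp only [LinearMap.comp_apply, LieAlgebra.ad_apply, lie_mon, coord_mon hn]
    rw [if_neg (by omega)]
    rfl
  exact LinearMap.congr_fun this z

/-- The bilinear map `(a, b) ↦` the coefficient of `E r` in `ω (a ⊗ E s, b ⊗ E t)`. -/
noncomputable def coeff (ω : twoCochain K (A ⊗[K] W p K) (A ⊗[K] W p K)) (r s t : ℕ) :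
    A →ₗ[K] A →ₗ[K] A :=
  (ω.1.compl₁₂ (mon p K s) (mon p K t)).compr₂ (coord p K r)

lemma coeff_apply (ω : twoCochain K (A ⊗[K] W p K) (A ⊗[K] W p K)) (r s t : ℕ) (a b : A) :
    coeff ω r s t a b = coord p K r (ω (mon p K s a) (mon p K t b)) := rfl

lemma coeff_skew (ω : twoCochain K (A ⊗[K] W p K) (A ⊗[K] W p K)) (r s t : ℕ) (a b : A) :
    coeff ω r s t a b = -coeff ω r t s b a := by
  rw [coeff_apply, coeff_apply, ← twoCochain_skew ω (mon p K s a), map_neg, neg_neg]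

lemma coeff_sub_mul (ω : twoCochain K (A ⊗[K] W p K) (A ⊗[K] W p K)) (r s t u v : ℕ) (a b : A) :
    coeff ω r s t (((u : A) - v) * a) b = ((u : A) - v) * coeff ω r s t a b := by
  have : ∀ x : A, ((u : A) - v) * x = ((u : K) - v) • x := fun x => by
    rw [Algebra.smul_def]; simp
  rw [this, this, map_smul, LinearMap.smul_apply]

lemma coeff_of_le_left (ω : twoCochain K (A ⊗[K] W p K) (A ⊗[K] W p K)) (r t : ℕ) {s : ℕ}
    (hs : p ≤ s) (a b : A) : coeff ω r s t a b = 0 := by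
  rw [coeff_apply, mon_of_le hs, map_zero, LinearMap.zero_apply, map_zero]

/-- The coefficient of `E n` in a cyclic term. The coefficient of `E r` with `s + r = n + 1` is the
only one of `ω (b ⊗ E t, c ⊗ E u)` that contributes. -/
lemma coord_cyclicTerm (ω : twoCochain K (A ⊗[K] W p K) (A ⊗[K] W p K)) {n s r : ℕ} (t u : ℕ)
    (hn : n < p) (h : s + r = n + 1) (a b c : A) :
    coord p K n (cyclicTerm ω (mon p K s a) (mon p K t b) (mon p K u c)) =
      ((r : A) - s) * (a * coeff ω r t u b c) -
        ((u : A) - t) * coeff ω n (t + u - 1) s (b * c) a := by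
  rw [cyclicTerm, map_sub, coord_lie_mon hn h, lie_mon, ← coeff_apply, ← coeff_apply,
    coeff_sub_mul]

lemma coord_cyclicTerm_of_lt (ω : twoCochain K (A ⊗[K] W p K) (A ⊗[K] W p K)) {n s : ℕ} (t u : ℕ)
    (hn : n < p) (h : n + 1 < s) (a b c : A) :
    coord p K n (cyclicTerm ω (mon p K s a) (mon p K t b) (mon p K u c)) =
      -(((u : A) - t) * coeff ω n (t + u - 1) s (b * c) a) := by
  rw [cyclicTerm, map_sub, coord_lie_mon_of_lt hn h, lie_mon, ← coeff_apply, coeff_sub_mul,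
    zero_sub]

lemma coord_cyclicTerm_sum {ω : twoCochain K (A ⊗[K] W p K) (A ⊗[K] W p K)}
    (hω : ω ∈ twoCocycle K (A ⊗[K] W p K) (A ⊗[K] W p K)) (n s t u : ℕ) (a b c : A) :
    coord p K n (cyclicTerm ω (mon p K s a) (mon p K t b) (mon p K u c)) +
      coord p K n (cyclicTerm ω (mon p K t b) (mon p K u c) (mon p K s a)) +
      coord p K n (cyclicTerm ω (mon p K u c) (mon p K s a) (mon p K t b)) = 0 := by
  rw [← map_add, ← map_add, cyclicTerm_sum_of_mem hω, map_zero]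

end Coordinates

section Classification

variable {p : ℕ} [Fact p.Prime] {K A : Type*} [Field K] [CharP K p] [CommRing A] [Algebra K A]
  {ω : twoCochain K (A ⊗[K] W p K) (A ⊗[K] W p K)}

/-! ### The component of degree `p` of a cocycle -/

/-- The coefficient of `E (p - 1)` at the pair `(E 0, E 0)`, which is the only coefficient in degree
`p`, is that of a cochain `Φ_D`. The derivation is found from the cocycle condition on
`(E 1, E 0, E 0)`. -/
lemma exists_derivation_coeff_zero_zero (hp : 2 < p)
    (hω : ω ∈ twoCocycle K (A ⊗[K] W p K) (A ⊗[K] W p K)) :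
    ∃ D : Derivation K A A, ∀ a b, coeff ω (p - 1) 0 0 a b = b * D a - a * D b := by
  have hp0 := cast_prime_eq_zero p K A
  have h2 : IsUnit ((2 : ℕ) : A) := isUnit_natCast p K (by omega) hp
  have key : ∀ a b c, 2 * (a * coeff ω (p - 1) 0 0 b c) =
      coeff ω (p - 1) 0 0 (a * b) c - coeff ω (p - 1) 0 0 (c * a) b := by
    intro a b c
    have h := coord_cyclicTerm_sum hω (p - 1) 1 0 0 a b c
    rw [coord_cyclicTerm ω 0 0 (by omega) (show 1 + (p - 1) = p - 1 + 1 by omega),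
      coord_cyclicTerm ω 0 1 (by omega) (show 0 + p = p - 1 + 1 by omega),
      coord_cyclicTerm ω 1 0 (by omega) (show 0 + p = p - 1 + 1 by omega),
      Nat.cast_sub (by omega), hp0] at h
    simp only [Nat.cast_zero, Nat.cast_one, add_zero, zero_add, Nat.sub_self] at h
    linear_combination -h
  set f := coeff ω (p - 1) 0 0 with hf
  have skew : ∀ a b, f a b = -f b a := coeff_skew ω _ 0 0
  have h1 : ∀ a c, f a c = 2 * (a * f 1 c) - f 1 (a * c) := by
    intro a c
    have := key a 1 c
    rw [mul_one, skew (c * a) 1, mul_comm c a] at this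
    linear_combination -this
  have leib : ∀ a c, f 1 (a * c) = a * f 1 c + c * f 1 a := by
    intro a c
    apply h2.mul_left_cancel
    have := skew a c
    rw [h1 a c, h1 c a, mul_comm c a] at this
    push_cast
    linear_combination -this
  refine ⟨-Derivation.mk' (f 1) leib, fun a b => ?_⟩
  change f a b = b * -f 1 a - a * -f 1 b
  rw [h1, leib]
  ring

/-! ### The component of degree `0` of a cocycle -/

/-- The cocycle condition on `(1 ⊗ E 0, b ⊗ E t, c ⊗ E u)` for a cocycle that vanishes on the pairs
`(1 ⊗ E 0, c ⊗ E u)`. -/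
lemma coeff_recursion (hω : ω ∈ twoCocycle K (A ⊗[K] W p K) (A ⊗[K] W p K))
    (hN : ∀ t, 0 < t → t < p → ∀ b, coeff ω (t - 1) 0 t 1 b = 0) {t u : ℕ} (hu : 0 < u)
    (h2 : 2 ≤ t + u) (hp : t + u ≤ p) (hup : u < p) (b c : A) :
    ((t : A) + u - 1) * coeff ω (t + u - 1) t u b c =
      u * coeff ω (t + u - 2) t (u - 1) b c + t * coeff ω (t + u - 2) (t - 1) u b c := by
  have hN' : ∀ t, 0 < t → t < p → ∀ b, coeff ω (t - 1) t 0 b 1 = 0 := fun t h0 ht b => by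
    rw [coeff_skew, hN t h0 ht, neg_zero]
  have h := coord_cyclicTerm_sum hω (t + u - 2) 0 t u 1 b c
  have e1 : t + u - 2 = t + u - 1 - 1 := by omega
  rw [coord_cyclicTerm ω t u (by omega) (show 0 + (t + u - 1) = t + u - 2 + 1 by omega),
    coord_cyclicTerm ω u 0 (by omega) (show t + (u - 1) = t + u - 2 + 1 by omega),
    hN' u hu hup, e1, hN' (t + u - 1) (by omega) (by omega), Nat.cast_sub (by omega)] at h
  rw [e1, coeff_skew ω _ t (u - 1)]
  rcases Nat.eq_zero_or_pos t with rfl | ht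
  · rw [coord_cyclicTerm_of_lt ω 0 0 (by omega) (by omega)] at h
    simp only [Nat.cast_zero, add_zero, zero_add, Nat.cast_one, one_mul, mul_one, mul_zero,
      zero_mul, sub_zero, zero_sub, neg_zero] at h ⊢
    linear_combination h
  · rw [coord_cyclicTerm ω 0 t (by omega) (show u + (t - 1) = t + u - 1 - 1 + 1 by omega),
      hN t ht (by omega)] at h
    push_cast at h
    simp only [add_zero, zero_add, one_mul, mul_one, mul_zero, sub_zero, zero_sub] at h
    linear_combination h

/-- The degree `0` part of a normalized cocycle is determined by its coefficient at the single pair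
`(E 0, E 1)`. -/
lemma coeff_eq_of_normalized (hω : ω ∈ twoCocycle K (A ⊗[K] W p K) (A ⊗[K] W p K))
    (hN : ∀ t, 0 < t → t < p → ∀ b, coeff ω (t - 1) 0 t 1 b = 0) (n : ℕ) :
    ∀ t u, t + u = n + 1 → n + 1 ≤ p → t < p → u < p → ∀ b c,
      coeff ω n t u b c = u * coeff ω 0 0 1 b c - t * coeff ω 0 0 1 c b := by
  induction n with
  | zero =>
    intro t u h _ _ _ b c
    obtain ⟨rfl, rfl⟩ | ⟨rfl, rfl⟩ : (t = 0 ∧ u = 1) ∨ (t = 1 ∧ u = 0) := by omega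
    · simp
    · rw [coeff_skew]
      simp
  | succ n ih =>
    have pos : ∀ t u, t + u = n + 1 + 1 → n + 1 + 1 ≤ p → u < p → 0 < u → t < p → ∀ b c,
        coeff ω (n + 1) t u b c = u * coeff ω 0 0 1 b c - t * coeff ω 0 0 1 c b := by
      intro t u h hn hup hu ht b c
      have hrec := coeff_recursion (t := t) hω hN hu (by omega) (by omega) hup b c
      rw [show t + u - 1 = n + 1 by omega, show t + u - 2 = n by omega,
        ih t (u - 1) (by omega) (by omega) ht (by omega), Nat.cast_sub (show 1 ≤ u from hu)] at hrec
      have hsum : (t : A) + u - 1 = ((n + 1 : ℕ) : A) := by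
        have := congrArg (Nat.cast : ℕ → A) h
        push_cast at this ⊢
        linear_combination this
      apply (isUnit_natCast p K (A := A) (show 0 < n + 1 by omega) (by omega)).mul_left_cancel
      rcases Nat.eq_zero_or_pos t with rfl | ht0
      · rw [← hsum, hrec]
        push_cast
        ring
      · rw [ih (t - 1) u (by omega) (by omega) (by omega) hup, Nat.cast_sub (by omega)] at hrec
        rw [← hsum, hrec]
        push_cast
        ring
    intro t u h hn ht hu b c
    rcases Nat.eq_zero_or_pos u with rfl | hu0
    · rw [coeff_skew, pos 0 t (by omega) hn ht (by omega) hu]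
      push_cast
      ring
    · exact pos t u h hn hu hu0 ht b c

/-- The bilinear map `P` describing the degree `0` part of a normalized cocycle is the sum of
`(a, b) ↦ b D(a)` with a derivation `D` and a Harrison cocycle. Here `D(a) = P(a, 1)`, and the
cocycle conditions on `(E 0, E 0, E 2)` and `(E 0, E 1, E 1)` give the identities needed. -/
lemma exists_derivation_harrisonCocycle (hp : 2 < p)
    (hω : ω ∈ twoCocycle K (A ⊗[K] W p K) (A ⊗[K] W p K))
    (hN : ∀ t, 0 < t → t < p → ∀ b, coeff ω (t - 1) 0 t 1 b = 0) :
    ∃ (D : Derivation K A A) (F : harrisonCocycle K A),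
      ∀ a b, coeff ω 0 0 1 a b = b * D a + F.1 a b := by
  have h2 : IsUnit ((2 : ℕ) : A) := isUnit_natCast p K (by omega) hp
  have hcoeff := coeff_eq_of_normalized hω hN 1
  set P := coeff ω 0 0 1 with hP
  have hskew : ∀ a b, coeff ω 0 1 0 a b = -P b a := coeff_skew ω 0 1 0
  have E1 : ∀ a b c, a * P b c - b * P a c - P b (c * a) + P a (b * c) = 0 := by
    intro a b c
    have h := coord_cyclicTerm_sum hω 0 0 0 2 a b c
    rw [coord_cyclicTerm ω 0 2 (by omega) (show 0 + 1 = 0 + 1 by omega),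
      coord_cyclicTerm ω 2 0 (by omega) (show 0 + 1 = 0 + 1 by omega),
      coord_cyclicTerm_of_lt ω 0 0 (by omega) (by omega),
      hcoeff 0 2 (by omega) (by omega) (by omega) (by omega),
      hcoeff 2 0 (by omega) (by omega) (by omega) (by omega)] at h
    simp only [Nat.add_one_sub_one, zero_add, add_zero, hskew] at h
    apply h2.mul_left_cancel
    push_cast at h ⊢
    linear_combination h
  have E2 : ∀ a b c, a * (P b c - P c b) + b * P a c + P (c * a) b - c * P a b -
      P (a * b) c = 0 := by
    intro a b c
    have h := coord_cyclicTerm_sum hω 0 0 1 1 a b c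
    rw [coord_cyclicTerm ω 1 1 (by omega) (show 0 + 1 = 0 + 1 by omega),
      coord_cyclicTerm ω 1 0 (by omega) (show 1 + 0 = 0 + 1 by omega),
      coord_cyclicTerm ω 0 1 (by omega) (show 1 + 0 = 0 + 1 by omega),
      hcoeff 1 1 (by omega) (by omega) (by omega) (by omega)] at h
    simp only [Nat.add_one_sub_one, zero_add, add_zero, hskew, Nat.sub_self, ← hP] at h
    push_cast at h ⊢
    linear_combination h
  have hP1 : ∀ b, P 1 b = 0 := hN 1 (by omega) (by omega)
  have hsymm : ∀ a b, P a b - P b a = b * P a 1 - a * P b 1 := by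
    intro a b
    have := E1 a b 1
    rw [one_mul, mul_one] at this
    linear_combination this
  have leib : ∀ a b, P (a * b) 1 = a * P b 1 + b * P a 1 := by
    intro a b
    have h := E2 a b 1
    rw [hP1, one_mul] at h
    linear_combination -h
  let D : Derivation K A A := Derivation.mk' (P.flip 1) leib
  have hD : ∀ a, D a = P a 1 := fun _ => rfl
  let F : A →ₗ[K] A →ₗ[K] A := P - (LinearMap.mul K A).comp D.toLinearMap
  have hF : ∀ a b, F a b = P a b - D a * b := fun _ _ => rfl
  refine ⟨D, ⟨F, fun a b => ?_, fun a b c => ?_⟩, fun a b => ?_⟩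
  · rw [hF, hF, hD, hD]
    linear_combination hsymm a b
  · rw [hF, hF, hF, hF, hD, hD, hD, leib]
    have h1 := hsymm (a * b) c
    have h2 := hsymm c b
    have h4 := E1 a c b
    rw [leib] at h1
    rw [mul_comm c b, mul_comm b a] at h4
    linear_combination h4 - h1 - a * h2
  · rw [hF]
    ring

end Classification

/-! ### The component of degree `-p` of a cocycle -/

section Negative

variable {p : ℕ} [Fact p.Prime] {K A : Type*} [Field K] [CharP K p] [CommRing A] [Algebra K A]
  {ω : twoCochain K (A ⊗[K] W p K) (A ⊗[K] W p K)}

/-- The cocycle condition on `(a ⊗ E 0, b ⊗ E t, c ⊗ E u)` in degree `-p`. -/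
lemma coeff_recursion_neg (hω : ω ∈ twoCocycle K (A ⊗[K] W p K) (A ⊗[K] W p K)) {n t u : ℕ}
    (h : t + u = p + 2 + n) (ht : t < p) (hu : u < p) (a b c : A) :
    ((n : A) + 1) * (a * coeff ω (n + 1) t u b c) =
      u * coeff ω n t (u - 1) b (c * a) + t * coeff ω n (t - 1) u (a * b) c := by
  have h1 := coord_cyclicTerm_sum hω n 0 t u a b c
  rw [coord_cyclicTerm ω t u (by omega) (show 0 + (n + 1) = n + 1 by omega),
    coord_cyclicTerm_of_lt ω u 0 (by omega) (by omega),
    coord_cyclicTerm_of_lt ω 0 t (by omega) (by omega),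
    coeff_of_le_left ω n 0 (show p ≤ t + u - 1 by omega), add_zero, zero_add,
    coeff_skew ω n (u - 1)] at h1
  push_cast at h1
  linear_combination h1

/-- The cocycle condition on `(a ⊗ E 1, b ⊗ E t, c ⊗ E u)` for `t + u = p + 1`. -/
lemma coeff_euler (hω : ω ∈ twoCocycle K (A ⊗[K] W p K) (A ⊗[K] W p K)) {t u : ℕ}
    (h : t + u = p + 1) (ht : t < p) (hu : u < p) (a b c : A) :
    t * coeff ω 0 t u b (c * a) =
      a * coeff ω 0 t u b c + ((t : A) - 1) * coeff ω 0 t u (a * b) c := by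
  have h1 := coord_cyclicTerm_sum hω 0 1 t u a b c
  rw [coord_cyclicTerm ω t u (by omega) (show 1 + 0 = 0 + 1 by omega),
    coord_cyclicTerm_of_lt ω u 1 (by omega) (by omega),
    coord_cyclicTerm_of_lt ω 1 t (by omega) (by omega),
    coeff_of_le_left ω 0 1 (show p ≤ t + u - 1 by omega), Nat.add_sub_cancel,
    Nat.add_sub_cancel_left, coeff_skew ω 0 u] at h1
  have hu : (u : A) = 1 - t := by
    have := congrArg (Nat.cast : ℕ → A) h
    push_cast at this
    rw [cast_prime_eq_zero p K A] at this
    linear_combination this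
  rw [hu] at h1
  push_cast at h1
  linear_combination h1

/-- At the pair `(E 2, E (p - 1))`, the coefficient in degree `-p` is `A`-bilinear. The cocycle
condition on `(E 2, E 2, E (p - 2))` makes it a function of the product `a * c`, as `p > 3`. -/
lemma coeff_two (hp : 3 < p) (hω : ω ∈ twoCocycle K (A ⊗[K] W p K) (A ⊗[K] W p K)) (a c : A) :
    coeff ω 0 2 (p - 1) a c = a * c * coeff ω 0 2 (p - 1) 1 1 := by
  have h4 : IsUnit (4 : A) := by
    have := isUnit_natCast p K (A := A) (show 0 < 2 by omega) (by omega)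
    convert this.mul this using 1
    norm_num
  have hsymm : ∀ a b c, coeff ω 0 2 (p - 1) a (b * c) = coeff ω 0 2 (p - 1) b (c * a) := by
    intro a b c
    have h1 := coord_cyclicTerm_sum hω 0 2 2 (p - 2) a b c
    rw [coord_cyclicTerm_of_lt ω 2 (p - 2) (by omega) (by omega),
      coord_cyclicTerm_of_lt ω (p - 2) 2 (by omega) (by omega),
      coord_cyclicTerm_of_lt ω 2 2 (by omega) (by omega), Nat.cast_sub (by omega),
      cast_prime_eq_zero p K A, show 2 + (p - 2) - 1 = p - 1 by omega,
      show p - 2 + 2 - 1 = p - 1 by omega, coeff_skew ω 0 (p - 1), coeff_skew ω 0 (p - 1)] at h1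
    apply h4.mul_left_cancel
    push_cast at h1
    linear_combination -h1
  have h1 : ∀ a c, coeff ω 0 2 (p - 1) a c = coeff ω 0 2 (p - 1) 1 (c * a) := by
    intro a c
    rw [← hsymm a 1 c, one_mul]
  have h2 : ∀ a, coeff ω 0 2 (p - 1) 1 a = a * coeff ω 0 2 (p - 1) 1 1 := by
    intro a
    have := coeff_euler hω (show 2 + (p - 1) = p + 1 by omega) (by omega) (by omega) a 1 1
    rw [h1 (a * 1), one_mul, one_mul, mul_one] at this
    push_cast at this
    linear_combination this
  rw [h1, h2, mul_comm c a]

/-- All the coefficients in degree `-p` with target `E 0` are `A`-bilinear: the property passes from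
`(E t, E (u + 1))` to `(E (t + 1), E u)`. -/
lemma coeff_line (hp : 3 < p) (hω : ω ∈ twoCocycle K (A ⊗[K] W p K) (A ⊗[K] W p K)) (t : ℕ) :
    ∀ u, t + 2 + u = p + 1 → t + 2 < p → ∀ a c,
      coeff ω 0 (t + 2) u a c = a * c * coeff ω 0 (t + 2) u 1 1 := by
  induction t with
  | zero =>
    intro u h _ a c
    obtain rfl : u = p - 1 := by omega
    exact coeff_two hp hω a c
  | succ t ih =>
    intro u h ht
    have hright : ∀ a b c, coeff ω 0 (t + 1 + 2) u b (c * a) = a * coeff ω 0 (t + 1 + 2) u b c := by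
      intro a b c
      have h1 := coeff_recursion_neg hω (n := 0) (show t + 3 + (u + 1) = p + 2 + 0 by omega)
        (by omega) (by omega) a b c
      have h2 := coeff_recursion_neg hω (n := 0) (show t + 3 + (u + 1) = p + 2 + 0 by omega)
        (by omega) (by omega) 1 b c
      rw [show t + 3 - 1 = t + 2 by omega, Nat.add_sub_cancel, ih (u + 1) (by omega) (by omega)]
        at h1 h2
      apply (isUnit_natCast p K (A := A) (show 0 < u + 1 by omega) (by omega)).mul_left_cancel
      rw [show t + 1 + 2 = t + 3 by omega]
      rw [mul_one c] at h2
      linear_combination -h1 + a * h2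
    have hleft : ∀ a b c, coeff ω 0 (t + 1 + 2) u (a * b) c = a * coeff ω 0 (t + 1 + 2) u b c := by
      intro a b c
      have h1 := coeff_euler hω h ht (by omega) a b c
      rw [hright] at h1
      apply (isUnit_natCast p K (A := A) (show 0 < t + 2 by omega) (by omega)).mul_left_cancel
      push_cast at h1 ⊢
      linear_combination -h1
    intro a c
    have h1 := hleft a 1 c
    have h2 := hright c 1 1
    rw [mul_one] at h1
    rw [one_mul] at h2
    rw [h1, h2, mul_assoc]

/-- The coefficients in degree `-p` with target `E 0` are proportional to those of `φ`. -/
lemma coeff_line_values (hp : 3 < p) (hω : ω ∈ twoCocycle K (A ⊗[K] W p K) (A ⊗[K] W p K))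
    {t u : ℕ} (htu : t + u = p + 1) (ht : t < p) (hu : u < p) :
    3 * coeff ω 0 t u 1 1 = (2 * (t : A) - 1) * coeff ω 0 2 (p - 1) 1 1 := by
  have hp0 := cast_prime_eq_zero p K A
  -- The defect `w` satisfies a two-term recursion, and it is odd under `t ↦ p + 1 - t`, so it
  -- vanishes at the centre `(p + 1) / 2`, hence below it by the recursion and above it by oddness.
  set w : ℕ → A := fun t =>
    3 * coeff ω 0 t (p + 1 - t) 1 1 - (2 * (t : A) - 1) * coeff ω 0 2 (p - 1) 1 1 with hw
  have oddness : ∀ t, 2 ≤ t → t < p → w (p + 1 - t) = -w t := by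
    intro t ht1 ht2
    simp only [hw]
    rw [show p + 1 - (p + 1 - t) = t by omega, coeff_skew ω 0 (p + 1 - t), Nat.cast_sub (by omega)]
    push_cast
    rw [hp0]
    ring
  have step : ∀ t, 2 ≤ t → t + 2 ≤ p → ((t : A) - 2) * w (t + 1) = ((t + 2 : ℕ) : A) * w t := by
    intro t ht1 ht2
    have h1 := coord_cyclicTerm_sum hω 0 2 t (p - t) 1 1 1
    rw [coord_cyclicTerm_of_lt ω t (p - t) (by omega) (by omega),
      coord_cyclicTerm_of_lt ω (p - t) 2 (by omega) (by omega),
      coord_cyclicTerm_of_lt ω 2 t (by omega) (by omega), Nat.cast_sub (by omega), hp0,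
      show t + (p - t) - 1 = p - 1 by omega, show p - t + 2 - 1 = p + 1 - t by omega,
      show 2 + t - 1 = t + 1 by omega, coeff_skew ω 0 (p - 1), coeff_skew ω 0 (p + 1 - t), mul_one]
      at h1
    simp only [hw]
    rw [show p + 1 - (t + 1) = p - t by omega]
    push_cast at h1 ⊢
    linear_combination -3 * h1
  obtain ⟨m, hm⟩ : ∃ m, p + 1 = 2 * m := by
    obtain ⟨k, hk⟩ := (Fact.out : p.Prime).odd_of_ne_two (by omega)
    exact ⟨k + 1, by omega⟩
  have centre : w m = 0 := by
    have h1 := oddness m (by omega) (by omega)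
    rw [show p + 1 - m = m by omega] at h1
    apply (isUnit_natCast p K (A := A) (show 0 < 2 by omega) (by omega)).mul_left_cancel
    push_cast
    linear_combination h1
  have below : ∀ k t, t + k = m → 2 ≤ t → w t = 0 := by
    intro k
    induction k with
    | zero =>
      rintro t rfl _
      exact centre
    | succ k ih =>
      intro t h h2
      have h1 := step t h2 (by omega)
      rw [ih (t + 1) (by omega) (by omega), mul_zero] at h1
      apply (isUnit_natCast p K (A := A) (show 0 < t + 2 by omega) (by omega)).mul_left_cancel
      rw [← h1, mul_zero]
  have all : w t = 0 := by
    rcases le_total t m with h | h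
    · exact below (m - t) t (by omega) (by omega)
    · have h1 := oddness (p + 1 - t) (by omega) (by omega)
      rw [show p + 1 - (p + 1 - t) = t by omega,
        below (m - (p + 1 - t)) (p + 1 - t) (by omega) (by omega), neg_zero] at h1
      exact h1
  simp only [hw] at all
  rw [show p + 1 - t = u by omega] at all
  exact sub_eq_zero.1 all

/-- The component of degree `-p` of a cocycle is an `A`-multiple of `φ`: the coefficients with
target `E (n + 1)` are determined by those with target `E n`. -/
lemma exists_coeff_neg_eq (hp : 3 < p) (hω : ω ∈ twoCocycle K (A ⊗[K] W p K) (A ⊗[K] W p K)) :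
    ∃ v : A, ∀ n t u, t + u = p + 1 + n → t < p → u < p → ∀ a b,
      coeff ω n t u a b = ((t : A) - u) * (a * b * v) := by
  have hp0 := cast_prime_eq_zero p K A
  have cast_add : ∀ {t u n : ℕ}, t + u = p + 1 + n → (t : A) + u = 1 + n := by
    intro t u n h
    have := congrArg (Nat.cast : ℕ → A) h
    push_cast at this
    rwa [hp0, zero_add] at this
  have h3 : IsUnit ((3 : ℕ) : A) := isUnit_natCast p K (by omega) hp
  obtain ⟨v, hv⟩ := h3.dvd (a := coeff ω 0 2 (p - 1) 1 1)
  refine ⟨v, fun n => ?_⟩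
  induction n with
  | zero =>
    intro t u h ht hu a b
    obtain ⟨t, rfl⟩ : ∃ s, t = s + 2 := ⟨t - 2, by omega⟩
    rw [coeff_line hp hω t u h ht]
    have h1 := coeff_line_values hp hω h ht hu
    have h2 := cast_add h
    rw [hv] at h1
    apply h3.mul_left_cancel
    push_cast at h1 h2 ⊢
    linear_combination (a * b) * h1 + 3 * a * b * v * h2
  | succ n ih =>
    intro t u h ht hu a b
    have h1 := coeff_recursion_neg hω (show t + u = p + 2 + n by omega) ht hu 1 a b
    rw [one_mul, one_mul, mul_one, ih t (u - 1) (by omega) ht (by omega),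
      ih (t - 1) u (by omega) (by omega) hu, Nat.cast_sub (by omega), Nat.cast_sub (by omega)] at h1
    have h2 := cast_add h
    apply (isUnit_natCast p K (A := A) (show 0 < n + 1 by omega) (by omega)).mul_left_cancel
    push_cast at h1 h2 ⊢
    rw [h1]
    linear_combination ((t : A) - u) * (a * b * v) * h2

end Negative

/-! ### Normal forms of cocycles -/

section NormalForm

variable {p : ℕ} [Fact p.Prime] {K A : Type*} [Field K] [CharP K p] [CommRing A] [Algebra K A]

/-- The 1-cochain `a ⊗ E s ↦ γ s a ⊗ E s`. -/
noncomputable def diagonal (p : ℕ) {K A : Type*} [Field K] [CommRing A] [Algebra K A]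
    (γ : ℕ → A →ₗ[K] A) : A ⊗[K] W p K →ₗ[K] A ⊗[K] W p K :=
  ∑ r ∈ Finset.range p, mon p K r ∘ₗ γ r ∘ₗ coord p K r

lemma diagonal_mon (γ : ℕ → A →ₗ[K] A) (s : ℕ) (a : A) :
    diagonal p γ (mon p K s a) = mon p K s (γ s a) := by
  by_cases hs : s < p
  · rw [diagonal, LinearMap.sum_apply, Finset.sum_eq_single s]
    · simp only [LinearMap.comp_apply, coord_mon_self hs]
    · intro r _ hr
      simp only [LinearMap.comp_apply, coord_mon_of_lt r hs, if_neg hr.symm, map_zero]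
    · exact fun h => absurd (Finset.mem_range.2 hs) h
  · rw [mon_of_le (not_lt.1 hs), mon_of_le (not_lt.1 hs), map_zero]

lemma lieDerivOne_torus_diagonal (γ : ℕ → A →ₗ[K] A) :
    lieDerivOne (torus p K A) (diagonal p γ) = 0 := by
  refine linearMap_ext_mon fun s _ a => ?_
  rw [lieDerivOne_apply, diagonal_mon, lie_torus_mon, lie_torus_mon, map_smul, diagonal_mon,
    sub_self, LinearMap.zero_apply]

/-- The degree `0` coefficients of a coboundary involve only the diagonal coefficients of `g`. -/
lemma coeff_d₁₂ (g : oneCochain K (A ⊗[K] W p K) (A ⊗[K] W p K)) {s t : ℕ} (h : 1 ≤ s + t)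
    (hp : s + t ≤ p) (a b : A) :
    coeff (d₁₂ K _ _ g) (s + t - 1) s t a b =
      ((t : A) - s) * (a * coord p K t (g (mon p K t b)) + b * coord p K s (g (mon p K s a)) -
        coord p K (s + t - 1) (g (mon p K (s + t - 1) (a * b)))) := by
  have hsmul : ((t : A) - s) * (a * b) = ((t : K) - s) • (a * b) := by
    rw [Algebra.smul_def]; simp
  rw [coeff_apply, d₁₂_apply_apply, map_sub, map_sub,
    coord_lie_mon (by omega) (show s + t = s + t - 1 + 1 by omega),
    coord_lie_mon (by omega) (show t + s = s + t - 1 + 1 by omega), lie_mon, hsmul, map_smul,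
    map_smul, map_smul, Algebra.smul_def]
  simp only [map_sub, map_natCast]
  ring

/-- Subtracting the coboundary of a diagonal cochain makes the degree `0` part of a 2-cochain vanish
on the pairs `(1 ⊗ E 0, b ⊗ E t)`: on these pairs the coboundary of `γ` with `γ 0 = 0` is
`t (γ t b - γ (t - 1) b)`, so `γ` is found by summation. -/
lemma exists_diagonal_normalized (ω : twoCochain K (A ⊗[K] W p K) (A ⊗[K] W p K)) :
    ∃ γ : ℕ → A →ₗ[K] A, ∀ t, 0 < t → t < p → ∀ b,
      coeff (ω - d₁₂ K _ _ (diagonal p γ)) (t - 1) 0 t 1 b = 0 := by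
  refine ⟨fun t => ∑ i ∈ Finset.range t, ((i + 1 : ℕ) : K)⁻¹ • coeff ω i 0 (i + 1) 1,
    fun t h0 ht b => ?_⟩
  set γ : ℕ → A →ₗ[K] A :=
    fun t => ∑ i ∈ Finset.range t, ((i + 1 : ℕ) : K)⁻¹ • coeff ω i 0 (i + 1) 1 with hγ
  obtain ⟨n, rfl⟩ : ∃ n, t = n + 1 := ⟨t - 1, by omega⟩
  have h1 : coeff (ω - d₁₂ K _ _ (diagonal p γ)) (n + 1 - 1) 0 (n + 1) 1 b =
      coeff ω n 0 (n + 1) 1 b - coeff (d₁₂ K _ _ (diagonal p γ)) n 0 (n + 1) 1 b :=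
    map_sub (coord p K n) _ _
  have h2 := coeff_d₁₂ (diagonal p γ) (show 1 ≤ 0 + (n + 1) by omega) (by omega) 1 b
  rw [show 0 + (n + 1) - 1 = n by omega] at h2
  have hn : ((n + 1 : ℕ) : K) ≠ 0 := by
    rw [Ne, CharP.cast_eq_zero_iff K p]
    exact fun hd => absurd (Nat.le_of_dvd h0 hd) (by omega)
  have hstep : γ (n + 1) b = γ n b + ((n + 1 : ℕ) : K)⁻¹ • coeff ω n 0 (n + 1) 1 b := by
    simp only [hγ, Finset.sum_range_succ, LinearMap.add_apply, LinearMap.smul_apply]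
  have hzero : γ 0 = 0 := by simp [hγ]
  rw [h1, h2, diagonal_mon, diagonal_mon, diagonal_mon, coord_mon_self ht,
    coord_mon_self (by omega), coord_mon_self (by omega), one_mul, one_mul, hstep, hzero,
    LinearMap.zero_apply, mul_zero, add_zero, add_sub_cancel_left, Nat.cast_zero, sub_zero,
    ← map_natCast (algebraMap K A), ← Algebra.smul_def, smul_smul, mul_inv_cancel₀ hn, one_smul,
    sub_self]

/-- A torus-invariant cochain is homogeneous for the grading by `ℤ/p`. -/
lemma eq_mon_coeff {ω : twoCochain K (A ⊗[K] W p K) (A ⊗[K] W p K)}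
    (hT : lieDerivTwo (torus p K A) ω = 0) {r s t : ℕ} (hr : r < p)
    (h : (p : ℤ) ∣ (r : ℤ) + 1 - s - t) (a b : A) :
    ω (mon p K s a) (mon p K t b) = mon p K r (coeff ω r s t a b) := by
  refine eq_mon_of_lie_torus (n := (s - 1) + (t - 1)) ?_ hr ?_
  · have h1 := lieDerivTwo_apply (torus p K A) ω (mon p K s a) (mon p K t b)
    rw [hT, lie_torus_mon, lie_torus_mon, map_smul, map_smul, LinearMap.smul_apply, sub_sub,
      ← add_smul] at h1
    push_cast
    exact sub_eq_zero.1 h1.symm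
  · convert h using 1
    ring

/-- Every 2-cocycle of `A ⊗ W₁(1)` is cohomologous to a combination of the standard ones. -/
lemma exists_normalForm (hp : 3 < p) {ω : twoCochain K (A ⊗[K] W p K) (A ⊗[K] W p K)}
    (hω : ω ∈ twoCocycle K (A ⊗[K] W p K) (A ⊗[K] W p K)) :
    ∃ (g : oneCochain K (A ⊗[K] W p K) (A ⊗[K] W p K)) (v : A) (D E : Derivation K A A)
      (F : harrisonCocycle K A),
      ω = d₁₂ K _ _ g + (Theta (W.phi p K) v + Psi p D + Phi p E + Upsilon (W p K) F) := by
  obtain ⟨g₁, hg₁⟩ := exists_lieDerivTwo_torus_eq_zero hω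
  obtain ⟨γ, hγ⟩ := exists_diagonal_normalized (ω - d₁₂ K _ _ g₁)
  set η := ω - d₁₂ K _ _ g₁ - d₁₂ K _ _ (diagonal p γ) with hη
  have hηmem : η ∈ twoCocycle K (A ⊗[K] W p K) (A ⊗[K] W p K) :=
    sub_d₁₂_mem_twoCocycle (sub_d₁₂_mem_twoCocycle hω g₁) (diagonal p γ)
  have hT : lieDerivTwo (torus p K A) η = 0 := by
    have h1 := map_sub (lieDerivTwo (torus p K A)) (ω - d₁₂ K _ _ g₁) (d₁₂ K _ _ (diagonal p γ))
    rw [hg₁, lieDerivTwo_d₁₂, lieDerivOne_torus_diagonal, map_zero] at h1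
    exact h1.trans (Subtype.ext (sub_self _))
  obtain ⟨E, hE⟩ := exists_derivation_coeff_zero_zero (by omega) hηmem
  obtain ⟨D, F, hDF⟩ := exists_derivation_harrisonCocycle (by omega) hηmem hγ
  obtain ⟨v, hv⟩ := exists_coeff_neg_eq hp hηmem
  refine ⟨g₁ + diagonal p γ, v, D, E, F, twoCochain_ext_mon fun s hs t ht a b => ?_⟩
  have hηω : η (mon p K s a) (mon p K t b) = ω (mon p K s a) (mon p K t b) -
      d₁₂ K _ _ g₁ (mon p K s a) (mon p K t b) -
        d₁₂ K _ _ (diagonal p γ) (mon p K s a) (mon p K t b) := rfl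
  have hd : d₁₂ K _ _ (g₁ + diagonal p γ) (mon p K s a) (mon p K t b) =
      d₁₂ K _ _ g₁ (mon p K s a) (mon p K t b) +
        d₁₂ K _ _ (diagonal p γ) (mon p K s a) (mon p K t b) := by
    rw [map_add]; rfl
  suffices h : η (mon p K s a) (mon p K t b) =
      Theta (W.phi p K) v (mon p K s a) (mon p K t b) + Psi p D (mon p K s a) (mon p K t b) +
        Phi p E (mon p K s a) (mon p K t b) + Upsilon (W p K) F (mon p K s a) (mon p K t b) by
    rw [hηω] at h
    simp only [add_apply_apply]
    rw [hd, ← h]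
    abel
  rw [Theta_phi_mon v hs ht, Psi_mon D hs ht, Phi_mon E hs ht, Upsilon_mon]
  by_cases h0 : s = 0 ∧ t = 0
  · obtain ⟨rfl, rfl⟩ := h0
    rw [eq_mon_coeff hT (r := p - 1) (by omega) ⟨1, by push_cast [show 1 ≤ p by omega]; ring⟩, hE]
    simp
  rw [if_neg h0, add_zero]
  by_cases h1 : s + t ≤ p
  · rw [eq_mon_coeff hT (r := s + t - 1) (by omega)
      ⟨0, by push_cast [show 1 ≤ s + t by omega]; ring⟩, if_neg (by omega), zero_add, ← map_add,
      coeff_eq_of_normalized hηmem hγ _ s t (by omega) (by omega) hs ht, hDF, hDF, F.2.1 b a]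
    congr 1
    ring
  · rw [eq_mon_coeff hT (r := s + t - 1 - p) (by omega)
      ⟨-1, by push_cast [show p ≤ s + t - 1 by omega, show 1 ≤ s + t by omega]; ring⟩,
      if_pos (by omega), mon_of_le (show p ≤ s + t - 1 by omega),
      mon_of_le (show p ≤ s + t - 1 by omega), add_zero, add_zero,
      hv _ s t (by omega) hs ht]

lemma harrisonDelta_apply (G : A →ₗ[K] A) (a b : A) :
    harrisonDelta K A G a b = a * G b + b * G a - G (a * b) := rfl

/-- A combination of the standard cocycles is a coboundary only if all its parts are trivial. -/
lemma eq_zero_of_normalForm_coboundary (hp : 3 < p)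
    {g : oneCochain K (A ⊗[K] W p K) (A ⊗[K] W p K)} {v : A} {D E : Derivation K A A}
    {F : harrisonCocycle K A}
    (h : Theta (W.phi p K) v + Psi p D + Phi p E + Upsilon (W p K) F = d₁₂ K _ _ g) :
    v = 0 ∧ D = 0 ∧ E = 0 ∧ F.1 ∈ harrisonCoboundary K A := by
  have hp0 := cast_prime_eq_zero p K A
  have happ : ∀ s t a b, Theta (W.phi p K) v (mon p K s a) (mon p K t b) +
      Psi p D (mon p K s a) (mon p K t b) + Phi p E (mon p K s a) (mon p K t b) +
        Upsilon (W p K) F (mon p K s a) (mon p K t b) =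
          d₁₂ K _ _ g (mon p K s a) (mon p K t b) := fun s t a b => by
    rw [← h]; rfl
  have hD : D = 0 := by
    -- On `(E 1, E 1)` only `Ψ_D` contributes.
    ext a
    have h1 := congrArg (coord p K 1) (happ 1 1 a 1)
    rw [Theta_phi_mon v (by omega) (by omega), if_neg (by omega), Psi_mon D (by omega) (by omega),
      Phi_mon E (by omega) (by omega), if_neg (by omega), Upsilon_mon, ← coeff_apply,
      coeff_d₁₂ g (s := 1) (t := 1) (by omega) (by omega)] at h1
    simpa [coord_mon_self (show 1 < p by omega)] using h1
  refine ⟨?_, hD, ?_, ?_⟩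
  · -- The coefficient of `E 0` at `(E 2, E (p - 1))` is `3v`.
    have h1 := congrArg (coord p K 0) (happ 2 (p - 1) 1 1)
    rw [Theta_phi_mon v (by omega) (by omega), if_pos (by omega), Psi_mon D (by omega) (by omega),
      Phi_mon E (by omega) (by omega), if_neg (by omega), Upsilon_mon, add_zero,
      mon_of_le (show p ≤ 2 + (p - 1) - 1 by omega), mon_of_le (show p ≤ 2 + (p - 1) - 1 by omega),
      add_zero, add_zero, show 2 + (p - 1) - 1 - p = 0 by omega, coord_mon_self (by omega),
      d₁₂_apply_apply, lie_mon, mon_of_le (show p ≤ 2 + (p - 1) - 1 by omega), map_zero, sub_zero,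
      map_sub, coord_lie_mon_of_lt (by omega) (by omega),
      coord_lie_mon_of_lt (by omega) (by omega), Nat.cast_sub (by omega), hp0] at h1
    apply (isUnit_natCast p K (A := A) (show 0 < 3 by omega) hp).mul_left_cancel
    push_cast at h1 ⊢
    linear_combination h1
  · -- The coefficient of `E (p - 1)` at `(E 0, E 0)` comes from `Φ_E` only.
    ext a
    have h1 := congrArg (coord p K (p - 1)) (happ 0 0 a 1)
    rw [Theta_phi_mon v (by omega) (by omega), if_neg (by omega), Psi_mon D (by omega) (by omega),
      Phi_mon E (by omega) (by omega), if_pos ⟨rfl, rfl⟩, Upsilon_mon,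
      d₁₂_apply_apply, lie_mon, map_sub (coord p K (p - 1)), map_sub (coord p K (p - 1)),
      coord_lie_mon (p := p) (by omega) (show 0 + p = p - 1 + 1 by omega),
      coord_lie_mon (p := p) (by omega) (show 0 + p = p - 1 + 1 by omega), hp0] at h1
    simpa [coord_mon_self (show p - 1 < p by omega)] using h1
  · -- On `(E 1, E 2)` only `Ψ_D` and `Υ_F` contribute; setting `b = 1` there determines the
    -- diagonal coefficient of `g` at `E 1` from the one at `E 2`, up to a multiple of the identity.
    have h12 : ∀ a b, 2 * (b * D a) - a * D b + F.1 a b =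
        a * coord p K 2 (g (mon p K 2 b)) + b * coord p K 1 (g (mon p K 1 a)) -
          coord p K 2 (g (mon p K 2 (a * b))) := by
      intro a b
      have h1 := congrArg (coord p K 2) (happ 1 2 a b)
      rw [Theta_phi_mon v (by omega) (by omega), if_neg (by omega), Psi_mon D (by omega) (by omega),
        Phi_mon E (by omega) (by omega), if_neg (by omega), Upsilon_mon, ← coeff_apply,
        coeff_d₁₂ g (s := 1) (t := 2) (by omega) (by omega), map_add, map_add, map_add, map_zero,
        show 1 + 2 - 1 = 2 by omega, coord_mon_self (by omega), coord_mon_self (by omega)] at h1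
      push_cast at h1
      linear_combination h1
    rw [hD] at h12
    have hF1 : ∀ a, F.1 a 1 = a * F.1 1 1 := by
      intro a
      have := F.2.2 a 1 1
      rw [mul_one, mul_one, mul_one] at this
      linear_combination -this
    refine ⟨coord p K 2 ∘ₗ g ∘ₗ mon p K 2 +
      LinearMap.mulLeft K (F.1 1 1 - coord p K 2 (g (mon p K 2 1))), ?_⟩
    ext a b
    rw [harrisonDelta_apply]
    simp only [LinearMap.add_apply, LinearMap.comp_apply, LinearMap.mulLeft_apply]
    have h1 := h12 a b
    have h2 := h12 a 1
    rw [hF1, mul_one] at h2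
    simp only [Derivation.zero_apply, mul_zero, sub_zero, zero_add] at h1 h2
    linear_combination b * h2 - h1

end NormalForm

/-! ### Cohomology classes -/

section Classes

variable {K L : Type*} [Field K] [LieRing L] [LieAlgebra K L]

lemma H1.cls_eq_iff {f g : oneCocycle K L} :
    H1.cls f = H1.cls g ↔ ∃ z, f.1 = LieAlgebra.ad K L z + g.1 := by
  rw [H1.cls, Submodule.mkQ_apply, Submodule.mkQ_apply, Submodule.Quotient.eq]
  constructor
  · rintro ⟨z, hz⟩
    exact ⟨z, sub_eq_iff_eq_add.1 hz.symm⟩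
  · rintro ⟨z, hz⟩
    refine ⟨z, ?_⟩
    simp [hz]

lemma H2.cls_eq_iff {ω η : twoCocycle K L L} :
    H2.cls ω = H2.cls η ↔ ∃ g, ω.1 = d₁₂ K L L g + η.1 := by
  rw [H2.cls, Submodule.mkQ_apply, Submodule.mkQ_apply, Submodule.Quotient.eq]
  constructor
  · rintro ⟨g, hg⟩
    refine ⟨g, ?_⟩
    rw [hg]
    exact (sub_add_cancel ω.1 η.1).symm
  · rintro ⟨g, hg⟩
    refine ⟨g, ?_⟩
    change _ = ω.1 - η.1
    rw [hg]
    exact (add_sub_cancel_right (d₁₂ K L L g) η.1).symm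

lemma H2.cls_add_eq_iff {ω η₁ η₂ η₃ η₄ : twoCocycle K L L} :
    H2.cls ω = H2.cls η₁ + H2.cls η₂ + H2.cls η₃ + H2.cls η₄ ↔
      ∃ g, ω.1 = d₁₂ K L L g + (η₁.1 + η₂.1 + η₃.1 + η₄.1) := by
  rw [← map_add, ← map_add, ← map_add, H2.cls_eq_iff]
  rfl

lemma H2.cls_surjective : Function.Surjective (H2.cls : twoCocycle K L L →ₗ[K] H2 K L) :=
  Submodule.mkQ_surjective _

lemma H2.cls_d₁₂ {ω : twoCocycle K L L} (g : oneCochain K L L) (h : ω.1 = d₁₂ K L L g) :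
    H2.cls ω = 0 := by
  rw [← map_zero H2.cls, H2.cls_eq_iff]
  exact ⟨g, h.trans (add_zero (d₁₂ K L L g)).symm⟩

lemma Har2.cls_eq_zero_iff {A : Type*} [CommRing A] [Algebra K A] {F : harrisonCocycle K A} :
    Har2.cls F = 0 ↔ F.1 ∈ harrisonCoboundary K A := by
  rw [Har2.cls, Submodule.mkQ_apply, Submodule.Quotient.mk_eq_zero]
  rfl

end Classes

/-! ### The maps from the parameters to cohomology -/

section Maps

/-- The linear map `D ↦ [1 ⊗ D]`. -/
noncomputable def oneTensorClass (K A L : Type*) [Field K] [CommRing A] [Algebra K A] [LieRing L]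
    [LieAlgebra K L] : Derivation K A A →ₗ[K] H1 K (A ⊗[K] L) :=
  H1.cls ∘ₗ
    { toFun := fun D => ⟨oneTensor L D, oneTensor_mem D⟩
      map_add' := fun D E => Subtype.ext (TensorProduct.ext' fun a x =>
        TensorProduct.add_tmul (D a) (E a) x)
      map_smul' := fun k D => Subtype.ext (TensorProduct.ext' fun a x =>
        (TensorProduct.smul_tmul' k (D a) x).symm) }

/-- The linear map `F ↦ Υ_F` to 2-cocycles. -/
noncomputable def upsilonCocycle (K A L : Type*) [Field K] [CommRing A] [Algebra K A] [LieRing L]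
    [LieAlgebra K L] : harrisonCocycle K A →ₗ[K] twoCocycle K (A ⊗[K] L) (A ⊗[K] L) where
  toFun F := ⟨Upsilon L F, Upsilon_mem F⟩
  map_add' F G := Subtype.ext <| twoCochain_ext_tmul fun a b x y =>
    TensorProduct.add_tmul (F.1 a b) (G.1 a b) ⁅x, y⁆
  map_smul' k F := Subtype.ext <| twoCochain_ext_tmul fun a b x y =>
    (TensorProduct.smul_tmul' k (F.1 a b) ⁅x, y⁆).symm

/-- The linear map `[F] ↦ [Υ_F]`. -/
noncomputable def upsilonClass (K A L : Type*) [Field K] [CommRing A] [Algebra K A] [LieRing L]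
    [LieAlgebra K L] : Har2 K A →ₗ[K] H2 K (A ⊗[K] L) :=
  Submodule.liftQ _ (H2.cls ∘ₗ upsilonCocycle K A L) (by
    rintro F ⟨G, hG⟩
    exact H2.cls_d₁₂ _ (Upsilon_harrisonDelta F G hG))

/-- The bilinear map `(φ, u) ↦ Θ_{φ,u}` to 2-cocycles. -/
noncomputable def thetaCocycle (K A L : Type*) [Field K] [CommRing A] [Algebra K A] [LieRing L]
    [LieAlgebra K L] : twoCocycle K L L →ₗ[K] A →ₗ[K] twoCocycle K (A ⊗[K] L) (A ⊗[K] L) :=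
  LinearMap.mk₂ K (fun φ u => ⟨Theta φ.1 u, Theta_mem φ u⟩)
    (fun φ ψ u => Subtype.ext <| twoCochain_ext_tmul fun a b x y =>
      TensorProduct.tmul_add (a * b * u) (φ.1 x y) (ψ.1 x y))
    (fun k φ u => Subtype.ext <| twoCochain_ext_tmul fun a b x y =>
      TensorProduct.tmul_smul k (a * b * u) (φ.1 x y))
    (fun φ u v => Subtype.ext <| twoCochain_ext_tmul fun a b x y => by
      change (a * b * (u + v)) ⊗ₜ[K] φ.1 x y = (a * b * u) ⊗ₜ[K] φ.1 x y + (a * b * v) ⊗ₜ[K] φ.1 x y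
      rw [mul_add, TensorProduct.add_tmul])
    (fun k φ u => Subtype.ext <| twoCochain_ext_tmul fun a b x y => by
      change (a * b * (k • u)) ⊗ₜ[K] φ.1 x y = k • ((a * b * u) ⊗ₜ[K] φ.1 x y)
      rw [mul_smul_comm, TensorProduct.smul_tmul'])

/-- The linear map `[φ] ⊗ u ↦ [Θ_{φ,u}]`. -/
noncomputable def thetaClass (K A L : Type*) [Field K] [CommRing A] [Algebra K A] [LieRing L]
    [LieAlgebra K L] : H2 K L ⊗[K] A →ₗ[K] H2 K (A ⊗[K] L) :=
  TensorProduct.lift (Submodule.liftQ _ ((thetaCocycle K A L).compr₂ H2.cls) (by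
    rintro φ ⟨g, hg⟩
    refine LinearMap.ext fun u => H2.cls_d₁₂ _ ((Theta_d₁₂ g u).symm.trans ?_).symm
    rw [hg]
    rfl))

variable (p : ℕ) [Fact p.Prime]

/-- The linear map `D ↦ [Ψ_D]`. -/
noncomputable def psiClass (K A : Type*) [Field K] [CharP K p] [CommRing A] [Algebra K A] :
    Derivation K A A →ₗ[K] H2 K (A ⊗[K] W p K) :=
  H2.cls ∘ₗ
    { toFun := fun D => ⟨Psi p D, Psi_mem D⟩
      map_add' := fun D E => Subtype.ext <| twoCochain_ext_tmul fun a b x y => by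
        change Psi p (D + E) _ _ = Psi p D _ _ + Psi p E _ _
        simp only [Psi_tmul, Derivation.add_apply, add_mul, mul_add, TensorProduct.add_tmul]
        abel
      map_smul' := fun k D => Subtype.ext <| twoCochain_ext_tmul fun a b x y => by
        change Psi p (k • D) (a ⊗ₜ x) (b ⊗ₜ y) = k • Psi p D (a ⊗ₜ x) (b ⊗ₜ y)
        simp only [Psi_tmul, Derivation.smul_apply, smul_mul_assoc, mul_smul_comm,
          TensorProduct.smul_tmul', smul_sub] }

/-- The linear map `D ↦ [Φ_D]`. -/
noncomputable def phiClass (K A : Type*) [Field K] [CharP K p] [CommRing A] [Algebra K A] :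
    Derivation K A A →ₗ[K] H2 K (A ⊗[K] W p K) :=
  H2.cls ∘ₗ
    { toFun := fun D => ⟨Phi p D, Phi_mem D⟩
      map_add' := fun D E => Subtype.ext <| twoCochain_ext_tmul fun a b x y => by
        change Phi p (D + E) _ _ = Phi p D _ _ + Phi p E _ _
        simp only [Phi_tmul, Derivation.add_apply, add_mul, mul_add, TensorProduct.add_tmul,
          TensorProduct.sub_tmul]
        abel
      map_smul' := fun k D => Subtype.ext <| twoCochain_ext_tmul fun a b x y => by
        change Phi p (k • D) (a ⊗ₜ x) (b ⊗ₜ y) = k • Phi p D (a ⊗ₜ x) (b ⊗ₜ y)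
        simp only [Phi_tmul, Derivation.smul_apply, smul_mul_assoc, mul_smul_comm,
          ← TensorProduct.smul_tmul', ← smul_sub] }

/-- The linear map `([φ] ⊗ u, D, E, [F]) ↦ [Θ_{φ,u}] + [Ψ_D] + [Φ_E] + [Υ_F]`. -/
noncomputable def standardClass (K A : Type*) [Field K] [CharP K p] [CommRing A] [Algebra K A] :
    ((H2 K (W p K) ⊗[K] A) × Derivation K A A × Derivation K A A × Har2 K A) →ₗ[K]
      H2 K (A ⊗[K] W p K) :=
  (thetaClass K A (W p K)).coprod
    ((psiClass p K A).coprod ((phiClass p K A).coprod (upsilonClass K A (W p K))))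

lemma standardClass_apply {K A : Type*} [Field K] [CharP K p] [CommRing A] [Algebra K A]
    (φ : twoCocycle K (W p K) (W p K)) (u : A) (D E : Derivation K A A) (F : harrisonCocycle K A) :
    standardClass p K A (H2.cls φ ⊗ₜ[K] u, D, E, Har2.cls F) =
      H2.cls ⟨Theta φ.1 u, Theta_mem φ u⟩ + H2.cls ⟨Psi p D, Psi_mem D⟩ +
        H2.cls ⟨Phi p E, Phi_mem E⟩ + H2.cls ⟨Upsilon (W p K) F, Upsilon_mem F⟩ := by
  rw [add_assoc, add_assoc]
  rfl

end Maps

/-! ### The first cohomology -/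

section FirstCohomology

variable {p : ℕ} [Fact p.Prime] {K A : Type*} [Field K] [CharP K p] [CommRing A] [Algebra K A]

/-- Every 1-cocycle is the sum of an inner derivation and a cocycle `1 ⊗ D`. -/
lemma exists_oneCocycle_normalForm {g : oneCochain K (A ⊗[K] W p K) (A ⊗[K] W p K)}
    (hg : g ∈ oneCocycle K (A ⊗[K] W p K)) :
    ∃ (z : A ⊗[K] W p K) (D : Derivation K A A),
      g = LieAlgebra.ad K _ z + oneTensor (W p K) D := by
  have hp := (Fact.out : p.Prime).two_le
  obtain ⟨z, hz⟩ := exists_lieDerivOne_torus_eq_zero hg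
  set f := g - LieAlgebra.ad K _ z with hf
  have hdf : d₁₂ K _ _ f = 0 := by
    rw [oneCocycle, LinearMap.mem_ker] at hg
    rw [hf, map_sub, hg, d₁₂_ad]
    exact Subtype.ext (sub_self _)
  have hdiag : ∀ s < p, ∀ a, f (mon p K s a) = mon p K s (coord p K s (f (mon p K s a))) := by
    intro s hs a
    refine eq_mon_of_lie_torus (n := s - 1) ?_ hs ⟨0, by ring⟩
    have h1 := lieDerivOne_apply (torus p K A) f (mon p K s a)
    rw [hz, lie_torus_mon, map_smul] at h1
    push_cast
    exact sub_eq_zero.1 h1.symm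
  let γ : ℕ → A →ₗ[K] A := fun s => coord p K s ∘ₗ f ∘ₗ mon p K s
  have hγ : ∀ s a, coord p K s (f (mon p K s a)) = γ s a := fun _ _ => rfl
  have hrel : ∀ t, 0 < t → t < p → ∀ a b, γ (t - 1) (a * b) = a * γ t b + b * γ 0 a := by
    intro t h0 ht a b
    have h1 := coeff_d₁₂ f (show 1 ≤ 0 + t by omega) (by omega) a b
    rw [hdf, hγ, hγ, hγ, zero_add, Nat.cast_zero, sub_zero] at h1
    apply (isUnit_natCast p K (A := A) h0 ht).mul_left_cancel
    have h2 : coeff (0 : twoCochain K (A ⊗[K] W p K) (A ⊗[K] W p K)) (t - 1) 0 t a b = 0 :=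
      map_zero (coord p K (t - 1))
    rw [h2] at h1
    linear_combination h1
  have hlin : ∀ t < p, ∀ b, γ t b = γ 0 b - t * (b * γ 0 1) := by
    intro t
    induction t with
    | zero => simp
    | succ t ih =>
      intro ht b
      have h1 := hrel (t + 1) (by omega) ht 1 b
      rw [one_mul, one_mul, Nat.add_sub_cancel, ih (by omega)] at h1
      push_cast
      linear_combination -h1
  have leib : ∀ a b, γ 1 (a * b) = a * γ 1 b + b * γ 1 a := by
    intro a b
    have h1 := hrel 1 (by omega) (by omega) a b
    rw [Nat.sub_self] at h1
    rw [hlin 1 (by omega) (a * b), hlin 1 (by omega) a, h1]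
    push_cast
    ring
  refine ⟨z + mon p K 1 (-γ 0 1), Derivation.mk' (γ 1) leib, ?_⟩
  rw [← sub_eq_iff_eq_add', map_add, ← sub_sub, ← hf, sub_eq_iff_eq_add']
  refine linearMap_ext_mon fun s hs a => ?_
  rw [LinearMap.add_apply, LieAlgebra.ad_apply, lie_mon, mon_apply s a, oneTensor_tmul, ← mon_apply,
    ← mon_apply, hdiag s hs, hγ, Nat.add_sub_cancel_left, ← map_add]
  congr 1
  change γ s a = _ + γ 1 a
  rw [hlin s hs, hlin 1 (by omega)]
  push_cast
  ring

lemma oneTensorClass_bijective : Function.Bijective (oneTensorClass K A (W p K)) := by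
  have hp := (Fact.out : p.Prime).two_le
  constructor
  · rw [← LinearMap.ker_eq_bot, LinearMap.ker_eq_bot']
    intro D hD
    have h1 : H1.cls (⟨oneTensor (W p K) D, oneTensor_mem D⟩ : oneCocycle K (A ⊗[K] W p K)) =
      H1.cls 0 := hD.trans (map_zero _).symm
    obtain ⟨z, hz⟩ := H1.cls_eq_iff.1 h1
    ext a
    -- The coefficient of `E 1` in `⁅z, a ⊗ E 1⁆` vanishes.
    have h2 := congrArg (coord p K 1) (LinearMap.congr_fun hz (mon p K 1 a))
    have h3 : (oneTensor (W p K) D) (mon p K 1 a) = mon p K 1 (D a) := rfl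
    have h4 : (LieAlgebra.ad K _ z + (0 : oneCocycle K (A ⊗[K] W p K)).1) (mon p K 1 a) =
      ⁅z, mon p K 1 a⁆ := add_zero _
    rw [h3, h4, coord_mon_self (by omega), ← lie_skew, map_neg,
      coord_lie_mon (by omega) (show 1 + 1 = 1 + 1 from rfl), sub_self, zero_mul, neg_zero] at h2
    exact h2
  · intro h
    obtain ⟨g, rfl⟩ := Submodule.mkQ_surjective _ h
    obtain ⟨z, D, hg⟩ := exists_oneCocycle_normalForm g.2
    exact ⟨D, (H1.cls_eq_iff.2 ⟨z, hg⟩).symm⟩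

end FirstCohomology

/-! ### The second cohomology -/

section SecondCohomology

variable {p : ℕ} [Fact p.Prime] {K A : Type*} [Field K] [CharP K p] [CommRing A] [Algebra K A]

/-- The case `A = K` of the normal form: `H²(W₁(1), W₁(1))` is spanned by the class of `φ`. -/
lemma exists_smul_phi (hp : 3 < p) (φ : twoCocycle K (W p K) (W p K)) :
    ∃ c : K, H2.cls φ = c • H2.cls ⟨W.phi p K, W.phi_mem⟩ := by
  obtain ⟨g, c, D, E, F, h⟩ := exists_normalForm hp (Theta_mem (A := K) φ 1)
  have hlid : ∀ (x : W p K) (z : K ⊗[K] W p K),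
      TensorProduct.lid K (W p K) ⁅(1 : K) ⊗ₜ[K] x, z⁆ = ⁅x, TensorProduct.lid K (W p K) z⁆ := by
    intro x z
    have : (TensorProduct.lid K (W p K)).toLinearMap ∘ₗ LieAlgebra.ad K _ ((1 : K) ⊗ₜ[K] x) =
        LieAlgebra.ad K _ x ∘ₗ (TensorProduct.lid K (W p K)).toLinearMap := by
      refine TensorProduct.ext' fun k y => ?_
      simp
    exact LinearMap.congr_fun this z
  refine ⟨c, ?_⟩
  rw [← map_smul, H2.cls_eq_iff]
  let g' : oneCochain K (W p K) (W p K) :=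
    (TensorProduct.lid K (W p K)).toLinearMap ∘ₗ g ∘ₗ TensorProduct.mk K K (W p K) 1
  have hg' : ∀ x, g' x = TensorProduct.lid K (W p K) (g (1 ⊗ₜ x)) := fun _ => rfl
  refine ⟨g' + F.1 1 1 • LinearMap.id, ?_⟩
  apply Subtype.ext
  refine LinearMap.ext fun x => LinearMap.ext fun y => ?_
  change φ.1 x y = d₁₂ K _ _ (g' + F.1 1 1 • LinearMap.id) x y + c • W.phi p K x y
  have h1 : Theta φ.1 (1 : K) ((1 : K) ⊗ₜ[K] x) ((1 : K) ⊗ₜ[K] y) =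
      d₁₂ K _ _ g (1 ⊗ₜ x) (1 ⊗ₜ y) + (Theta (W.phi p K) c (1 ⊗ₜ x) (1 ⊗ₜ y) +
        Psi p D (1 ⊗ₜ x) (1 ⊗ₜ y) + Phi p E (1 ⊗ₜ x) (1 ⊗ₜ y) +
          Upsilon (W p K) F (1 ⊗ₜ x) (1 ⊗ₜ y)) := by
    rw [h]; rfl
  rw [Theta_tmul, Theta_tmul, Psi_tmul, Phi_tmul, Upsilon_tmul, d₁₂_apply_apply, lie_tmul_tmul,
    D.map_one_eq_zero, E.map_one_eq_zero] at h1
  have h2 := congrArg (TensorProduct.lid K (W p K)) h1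
  simp only [map_add, map_sub, hlid, mul_one, mul_zero, sub_zero, add_zero,
    TensorProduct.zero_tmul, TensorProduct.lid_tmul, one_mul, one_smul, ← hg'] at h2
  rw [h2, d₁₂_apply_apply]
  simp only [LinearMap.add_apply, LinearMap.smul_apply, LinearMap.id_apply, lie_add, lie_smul]
  rw [← lie_skew x y, smul_neg]
  abel

lemma exists_eq_tmul_of_span {R V M : Type*} [CommRing R] [AddCommGroup V] [Module R V]
    [AddCommGroup M] [Module R M] {v : V} (hv : ∀ x : V, ∃ c : R, x = c • v) (z : V ⊗[R] M) :
    ∃ u : M, z = v ⊗ₜ[R] u := by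
  induction z with
  | zero => exact ⟨0, (TensorProduct.tmul_zero _ _).symm⟩
  | add x y hx hy =>
    obtain ⟨u, rfl⟩ := hx
    obtain ⟨w, rfl⟩ := hy
    exact ⟨u + w, (TensorProduct.tmul_add _ _ _).symm⟩
  | tmul x m =>
    obtain ⟨c, rfl⟩ := hv x
    exact ⟨c • m, TensorProduct.smul_tmul _ _ _⟩

lemma exists_eq_smul_phi (hp : 3 < p) (x : H2 K (W p K)) :
    ∃ c : K, x = c • H2.cls ⟨W.phi p K, W.phi_mem⟩ := by
  obtain ⟨φ, rfl⟩ := H2.cls_surjective x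
  exact exists_smul_phi hp φ

lemma exists_eq_phi_tmul (hp : 3 < p) (z : H2 K (W p K) ⊗[K] A) :
    ∃ u : A, z = H2.cls ⟨W.phi p K, W.phi_mem⟩ ⊗ₜ[K] u :=
  exists_eq_tmul_of_span (exists_eq_smul_phi hp) z

lemma exists_cls_eq (hp : 3 < p) (ω : twoCocycle K (A ⊗[K] W p K) (A ⊗[K] W p K)) :
    ∃ (u : A) (D E : Derivation K A A) (F : harrisonCocycle K A),
      H2.cls ω = H2.cls ⟨Theta (W.phi p K) u, Theta_mem ⟨W.phi p K, W.phi_mem⟩ u⟩ +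
        H2.cls ⟨Psi p D, Psi_mem D⟩ + H2.cls ⟨Phi p E, Phi_mem E⟩ +
          H2.cls ⟨Upsilon (W p K) F, Upsilon_mem F⟩ := by
  have h := exists_normalForm hp ω.2
  obtain ⟨g, u, D, E, F, hω⟩ := h
  refine ⟨u, D, E, F, ?_⟩
  exact H2.cls_add_eq_iff.2 ⟨g, hω⟩

lemma exists_standardClass (hp : 3 < p) (h : H2 K (A ⊗[K] W p K)) :
    ∃ (u : A) (D E : Derivation K A A) (F : harrisonCocycle K A),
      h = H2.cls ⟨Theta (W.phi p K) u, Theta_mem ⟨W.phi p K, W.phi_mem⟩ u⟩ +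
        H2.cls ⟨Psi p D, Psi_mem D⟩ + H2.cls ⟨Phi p E, Phi_mem E⟩ +
          H2.cls ⟨Upsilon (W p K) F, Upsilon_mem F⟩ := by
  obtain ⟨ω, hω⟩ := H2.cls_surjective h
  rw [← hω]
  exact exists_cls_eq hp ω

lemma eq_zero_of_cls_eq_zero (hp : 3 < p) {u : A} {D E : Derivation K A A}
    {F : harrisonCocycle K A}
    (h : H2.cls ⟨Theta (W.phi p K) u, Theta_mem ⟨W.phi p K, W.phi_mem⟩ u⟩ +
      H2.cls ⟨Psi p D, Psi_mem D⟩ + H2.cls ⟨Phi p E, Phi_mem E⟩ +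
        H2.cls ⟨Upsilon (W p K) F, Upsilon_mem F⟩ = 0) :
    u = 0 ∧ D = 0 ∧ E = 0 ∧ Har2.cls F = 0 := by
  obtain ⟨g, hg⟩ := H2.cls_add_eq_iff.1 ((map_zero H2.cls).trans h.symm)
  rw [Har2.cls_eq_zero_iff]
  apply eq_zero_of_normalForm_coboundary hp (g := -g)
  rw [map_neg]
  exact (neg_eq_of_add_eq_zero_right hg.symm).symm

lemma standardClass_injective (hp : 3 < p) : Function.Injective (standardClass p K A) := by
  rw [← LinearMap.ker_eq_bot, LinearMap.ker_eq_bot']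
  rintro ⟨z, D, E, f⟩ h
  obtain ⟨u, hu⟩ := exists_eq_phi_tmul hp z
  obtain ⟨F, hf⟩ : ∃ F, Har2.cls F = f := Submodule.mkQ_surjective _ f
  rw [hu, ← hf, standardClass_apply] at h
  have h0 := eq_zero_of_cls_eq_zero hp h
  rw [hu, ← hf, h0.1, h0.2.1, h0.2.2.1, h0.2.2.2, TensorProduct.tmul_zero]
  rfl

lemma standardClass_bijective (hp : 3 < p) : Function.Bijective (standardClass p K A) := by
  refine ⟨standardClass_injective hp, fun h => ?_⟩
  obtain ⟨u, D, E, F, hh⟩ := exists_standardClass hp h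
  exact ⟨_, (standardClass_apply p ⟨W.phi p K, W.phi_mem⟩ u D E F).trans hh.symm⟩

lemma span_union_range_eq_top {R M ι₁ ι₂ ι₃ ι₄ : Type*} [CommRing R] [AddCommGroup M] [Module R M]
    (f₁ : ι₁ → M) (f₂ : ι₂ → M) (f₃ : ι₃ → M) (f₄ : ι₄ → M)
    (h : ∀ x, ∃ a b c d, x = f₁ a + f₂ b + f₃ c + f₄ d) :
    Submodule.span R (Set.range f₁ ∪ Set.range f₂ ∪ Set.range f₃ ∪ Set.range f₄) = ⊤ := by
  rw [eq_top_iff]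
  intro x _
  obtain ⟨a, b, c, d, rfl⟩ := h x
  refine add_mem (add_mem (add_mem ?_ ?_) ?_) ?_ <;> apply Submodule.subset_span
  · exact Or.inl (Or.inl (Or.inl ⟨a, rfl⟩))
  · exact Or.inl (Or.inl (Or.inr ⟨b, rfl⟩))
  · exact Or.inl (Or.inr ⟨c, rfl⟩)
  · exact Or.inr ⟨d, rfl⟩

lemma span_standardClasses (hp : 3 < p) :
    Submodule.span K
      (Set.range (fun u : A => H2.cls ⟨Theta (W.phi p K) u, Theta_mem ⟨W.phi p K, W.phi_mem⟩ u⟩) ∪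
        Set.range (fun D : Derivation K A A => H2.cls ⟨Psi p D, Psi_mem D⟩) ∪
        Set.range (fun D : Derivation K A A => H2.cls ⟨Phi p D, Phi_mem D⟩) ∪
        Set.range (fun F : harrisonCocycle K A =>
          H2.cls ⟨Upsilon (W p K) F, Upsilon_mem F⟩)) = ⊤ :=
  span_union_range_eq_top _ _ _ _ (exists_standardClass hp)

end SecondCohomology

end CurrentWitt

theorem proposition2p1 (p : ℕ) [Fact p.Prime] (hp : 3 < p) (K : Type*) [Field K] [CharP K p]
    (A : Type*) [CommRing A] [Algebra K A] :
    (∃ h : ∀ D : Derivation K A A, oneTensor (W p K) D ∈ oneCocycle K (A ⊗[K] W p K),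
      ∃ e : Derivation K A A ≃ₗ[K] H1 K (A ⊗[K] W p K),
        ∀ D, e D = H1.cls ⟨oneTensor (W p K) D, h D⟩) ∧
    (∃ (hφ : W.phi p K ∈ twoCocycle K (W p K) (W p K))
      (hΘ : ∀ (φ : twoCocycle K (W p K) (W p K)) (u : A),
        Theta φ.1 u ∈ twoCocycle K (A ⊗[K] W p K) (A ⊗[K] W p K))
      (hΨ : ∀ D : Derivation K A A, Psi p D ∈ twoCocycle K (A ⊗[K] W p K) (A ⊗[K] W p K))
      (hΦ : ∀ D : Derivation K A A, Phi p D ∈ twoCocycle K (A ⊗[K] W p K) (A ⊗[K] W p K))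
      (hΥ : ∀ F : harrisonCocycle K A,
        Upsilon (W p K) F ∈ twoCocycle K (A ⊗[K] W p K) (A ⊗[K] W p K)),
      (∃ e : ((H2 K (W p K) ⊗[K] A) × Derivation K A A × Derivation K A A × Har2 K A) ≃ₗ[K]
          H2 K (A ⊗[K] W p K),
        ∀ (φ : twoCocycle K (W p K) (W p K)) (u : A) (D E : Derivation K A A)
          (F : harrisonCocycle K A),
          e (H2.cls φ ⊗ₜ[K] u, D, E, Har2.cls F) =
            H2.cls ⟨Theta φ.1 u, hΘ φ u⟩ + H2.cls ⟨Psi p D, hΨ D⟩ + H2.cls ⟨Phi p E, hΦ E⟩ +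
              H2.cls ⟨Upsilon (W p K) F, hΥ F⟩) ∧
      Submodule.span K
        (Set.range (fun u : A => H2.cls ⟨Theta (W.phi p K) u, hΘ ⟨W.phi p K, hφ⟩ u⟩) ∪
          Set.range (fun D : Derivation K A A => H2.cls ⟨Psi p D, hΨ D⟩) ∪
          Set.range (fun D : Derivation K A A => H2.cls ⟨Phi p D, hΦ D⟩) ∪
          Set.range (fun F : harrisonCocycle K A => H2.cls ⟨Upsilon (W p K) F, hΥ F⟩)) = ⊤) := by
  exact ⟨⟨oneTensor_mem, LinearEquiv.ofBijective _ oneTensorClass_bijective, fun D => rfl⟩,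
    W.phi_mem, Theta_mem, Psi_mem, Phi_mem, Upsilon_mem,
    ⟨LinearEquiv.ofBijective _ (standardClass_bijective hp), fun φ u D E F =>
      standardClass_apply p φ u D E F⟩, span_standardClasses hp⟩
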